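/- **Setting.** Two objects $o_1,o_2$ take values in domains $V_1,V_2$ with at least two elements each and have initial values $v_1^0,v_2^0$. The transactions are $\mathrm{READ}(S)$, for a nonempty set $S$ of objects, which returns the current values of the objects in $S$, and $\mathrm{WRITE}(u)$, which assigns new values to a nonempty set of objects and returns $ok$. The system has four processes: a reader $r$, which initiates only READ transactions, a writer $w$, which initiates only WRITE transactions, and servers $s_1,s_2$, where $s_i$ manages $o_i$. An algorithm consists of an arbitrary message alphabet and, for each process, an I/O automaton with at most countably many tasks. The processes are composed with reliable asynchronous (non-FIFO) channels, one in each direction between every client and every server and between the two servers. There is no channel between the clients. Invocations $INV$ of transactions are input actions, and responses $RESP$ output actions, of the client concerned. The reader and $s_i$ carry out reads by means of read requests from $r$ to $s_i$ and value messages from $s_i$ to $r$, each carrying one designated value of $o_i$ (possibly with further information); servers send no other messages to the reader. The reader may send arbitrary other messages to the servers, and the messages between $w$ and the servers and between the servers are arbitrary. An execution is well-formed if each client invokes a transaction only after its previous ones have completed. A finite execution is fair if no task is enabled in its last state; an infinite one is fair if for every task, either actions of the task occur infinitely often or states in which it is not enabled do. An algorithm satisfies the SNOW properties if: * **S (strict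 serializability).** In every well-formed fair execution, one can select some incomplete transactions together with responses for them, and assign distinct serialization points to these and to all complete transactions, after the invocation and (for complete transactions) before the response, such that the transactions with their responses, in the order of their points, form a sequential execution of the data type from $(v_1^0,v_2^0)$. * **N (non-blocking).** In every fair execution of the automaton of $s_i$ in which a read request from $r$ is received and no input action follows, $s_i$ eventually sends a value message to $r$. * **O (one response).** (a) The reader does not wait for messages before issuing its requests: in every well-formed fair execution of the automaton of $r$ in which $\mathrm{READ}(S)$ is invoked and no input action follows, $r$ eventually sends a read request to $s_i$ for each $o_i\in S$. (b) In every well-formed fair execution of the system, read requests are sent to $s_i$ only as part of a pending READ involving $o_i$, at most once per READ; $s_i$ sends a value message to $r$ only in response to a received read request, at most once per request; and for every complete READ and each object $o_i$ in it, between $INV$ and $RESP$, a request to $s_i$ is sent and received, and then one value message of $s_i$ is sent and received, and the value in it is the value that the READ returns for $o_i$. * **W (conflicting writes, with liveness).** Transactions may be invoked at any time subject to well-formedness, in particular WRITEs concurrently with READs of the same objects, and in every well-formed fair execution every invoked READ and every invoked WRITE eventually completes. **Theorem.** No algorithm in this setting satisfies the SNOW properties. -/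

import Mathlib

universe u v

namespace Snow

/-! ### I/O automata -/

/-- An I/O automaton over a universe `Act` of actions: disjoint sets of input, output and internal
actions, a nonempty set of start states, a transition relation in which every input action is
enabled in every state, and a partition of the locally controlled (output and internal) actions
into tasks. -/
structure IOAutomaton (Act : Type u) where
  State : Type u
  input : Set Act
  output : Set Act
  internal : Set Act
  input_output : Disjoint input output
  input_internal : Disjoint input internal
  output_internal : Disjoint output internal
  start : Set State
  start_nonempty : start.Nonempty
  step : State → Act → State → Prop
  step_sig : ∀ s a s', step s a s' → a ∈ input ∪ output ∪ internal
  input_enabled : ∀ s, ∀ a ∈ input, ∃ s', step s a s'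
  Task : Type u
  task : Task → Set Act
  task_cover : ⋃ t, task t = output ∪ internal
  task_disjoint : ∀ t t', t ≠ t' → Disjoint (task t) (task t')

namespace IOAutomaton

variable {Act : Type u}

/-- All actions of the signature. -/
def acts (A : IOAutomaton Act) : Set Act := A.input ∪ A.output ∪ A.internal

/-- Some action of the task `t` is enabled in the state `s`. -/
def TaskEnabled (A : IOAutomaton Act) (t : A.Task) (s : A.State) : Prop :=
  ∃ a ∈ A.task t, ∃ s', A.step s a s'

/-- Compatibility of a (finite) collection of automata. -/
structure Compatible {ι : Type v} (A : ι → IOAutomaton Act) : Prop where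
  internal_acts : ∀ i j, i ≠ j → Disjoint (A i).internal (A j).acts
  output_output : ∀ i j, i ≠ j → Disjoint (A i).output (A j).output

/-- The composition of a compatible collection of automata: an action is performed simultaneously
by all the components that have it in their signature, while the others do not move.  An action that
is an output of one component and an input of others is an output of the composition. -/
def compose {ι : Type} (A : ι → IOAutomaton Act) (hA : Compatible A) : IOAutomaton Act where
  State := ∀ i, (A i).State
  input := (⋃ i, (A i).input) \ ⋃ i, (A i).output
  output := ⋃ i, (A i).output
  internal := ⋃ i, (A i).internal
  input_output := Set.disjoint_sdiff_left
  input_internal := by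
    rw [Set.disjoint_left]
    rintro a ⟨ha, -⟩ hb
    obtain ⟨i, hi⟩ := Set.mem_iUnion.1 ha
    obtain ⟨j, hj⟩ := Set.mem_iUnion.1 hb
    by_cases h : j = i
    · subst h
      exact Set.disjoint_left.1 (A j).input_internal hi hj
    · exact Set.disjoint_left.1 (hA.internal_acts j i h) hj (Or.inl (Or.inl hi))
  output_internal := by
    rw [Set.disjoint_left]
    rintro a ha hb
    obtain ⟨i, hi⟩ := Set.mem_iUnion.1 ha
    obtain ⟨j, hj⟩ := Set.mem_iUnion.1 hb
    by_cases h : j = i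
    · subst h
      exact Set.disjoint_left.1 (A j).output_internal hi hj
    · exact Set.disjoint_left.1 (hA.internal_acts j i h) hj (Or.inl (Or.inr hi))
  start := {s | ∀ i, s i ∈ (A i).start}
  start_nonempty := ⟨fun i => (A i).start_nonempty.some, fun i => (A i).start_nonempty.some_mem⟩
  step s a s' := (∃ i, a ∈ (A i).acts) ∧
    ∀ i, (a ∈ (A i).acts → (A i).step (s i) a (s' i)) ∧ (a ∉ (A i).acts → s' i = s i)
  step_sig := by
    rintro s a s' ⟨⟨i, hi⟩, -⟩
    by_cases ho : a ∈ ⋃ i, (A i).output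
    · exact Or.inl (Or.inr ho)
    · rcases hi with (hi | hi) | hi
      · exact Or.inl (Or.inl ⟨Set.mem_iUnion.2 ⟨i, hi⟩, ho⟩)
      · exact Or.inl (Or.inr (Set.mem_iUnion.2 ⟨i, hi⟩))
      · exact Or.inr (Set.mem_iUnion.2 ⟨i, hi⟩)
  input_enabled := by
    rintro s a ⟨ha, ho⟩
    obtain ⟨i₀, hi₀⟩ := Set.mem_iUnion.1 ha
    have key : ∀ i, ∃ x, (a ∈ (A i).acts → (A i).step (s i) a x) ∧
        (a ∉ (A i).acts → x = s i) := by
      intro i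
      by_cases h : a ∈ (A i).acts
      · rcases h with (hi | hi) | hi
        · obtain ⟨x, hx⟩ := (A i).input_enabled (s i) a hi
          exact ⟨x, fun _ => hx, fun hn => absurd (Or.inl (Or.inl hi)) hn⟩
        · exact absurd (Set.mem_iUnion.2 ⟨i, hi⟩) ho
        · by_cases hii : i = i₀
          · subst hii
            exact absurd hi (Set.disjoint_left.1 (A i).input_internal hi₀)
          · exact absurd (Or.inl (Or.inl hi₀))
              (Set.disjoint_left.1 (hA.internal_acts i i₀ hii) hi)
      · exact ⟨s i, fun hn => absurd hn h, fun _ => rfl⟩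
    choose x hx using key
    exact ⟨x, ⟨i₀, Or.inl (Or.inl hi₀)⟩, hx⟩
  Task := Σ i, (A i).Task
  task t := (A t.1).task t.2
  task_cover := by
    rw [Set.iUnion_sigma, ← Set.iUnion_union_distrib]
    exact Set.iUnion_congr fun i => (A i).task_cover
  task_disjoint := by
    have hsub : ∀ i t, (A i).task t ⊆ (A i).output ∪ (A i).internal := fun i t => by
      rw [← (A i).task_cover]
      exact Set.subset_iUnion (A i).task t
    rintro ⟨i, t⟩ ⟨j, t'⟩ hne
    by_cases h : i = j
    · subst h
      exact (A i).task_disjoint t t' fun h => hne (by rw [h])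
    · rw [Set.disjoint_left]
      intro a ha hb
      rcases hsub i t ha with ha' | ha'
      · rcases hsub j t' hb with hb' | hb'
        · exact Set.disjoint_left.1 (hA.output_output i j h) ha' hb'
        · exact Set.disjoint_left.1 (hA.internal_acts j i (Ne.symm h)) hb' (Or.inl (Or.inr ha'))
      · rcases hsub j t' hb with hb' | hb'
        · exact Set.disjoint_left.1 (hA.internal_acts i j h) ha' (Or.inl (Or.inr hb'))
        · exact Set.disjoint_left.1 (hA.internal_acts i j h) ha' (Or.inr hb')

/-- A finite or infinite execution `st 0, act 0, st 1, act 1, st 2, …` with `len` actions.  The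
values of `act` from `len` on, and of `st` after `len`, are irrelevant. -/
structure Execution (A : IOAutomaton Act) where
  len : ℕ∞
  st : ℕ → A.State
  act : ℕ → Act
  st_zero : st 0 ∈ A.start
  st_succ : ∀ n : ℕ, (n : ℕ∞) < len → A.step (st n) (act n) (st (n + 1))

/-- The `n`-th action of `α` exists and is `a`. -/
def Execution.Occurs {A : IOAutomaton Act} (α : A.Execution) (n : ℕ) (a : Act) : Prop :=
  (n : ℕ∞) < α.len ∧ α.act n = a

/-- Fairness: a finite execution ends in a state in which no task is enabled; in an infinite one,
for each task, either actions of the task occur infinitely often, or states in which the task is not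
enabled occur infinitely often. -/
def Execution.Fair {A : IOAutomaton Act} (α : A.Execution) : Prop :=
  ∀ t : A.Task,
    (∀ N : ℕ, α.len = N → ¬ A.TaskEnabled t (α.st N)) ∧
    (α.len = ⊤ → {n | α.act n ∈ A.task t}.Infinite ∨ {n | ¬ A.TaskEnabled t (α.st n)}.Infinite)

end IOAutomaton

/-! ### The data type: two objects with read and write transactions -/

/-- Invocations: `READ` of a nonempty set of objects, and `WRITE` of values to a nonempty set of
objects (`u i = none` if the object `i` is not written). -/
inductive Inv (V : Fin 2 → Type u) : Type u
  | read (S : Finset (Fin 2)) (hS : S.Nonempty)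
  | write (u : ∀ i, Option (V i)) (hu : ∃ i, u i ≠ none)

/-- Responses: the tuple of values read (`none` for the objects that were not read), and `ok`. -/
inductive Resp (V : Fin 2 → Type u) : Type u
  | values (u : ∀ i, Option (V i))
  | ok

/-- The sequential specification: response and new values of the objects. -/
def Inv.apply {V : Fin 2 → Type u} : Inv V → (∀ i, V i) → Resp V × (∀ i, V i)
  | .read S _, x => (.values fun i => if i ∈ S then some (x i) else none, x)
  | .write u _, x => (.ok, fun i => (u i).getD (x i))

/-! ### The system: a reader, a writer, two servers, and channels -/

/-- The processes; `server i` manages the object `i`. -/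
inductive Proc : Type
  | reader
  | writer
  | server (i : Fin 2)

/-- The reader initiates the `READ` transactions and the writer the `WRITE` transactions. -/
def Inv.client {V : Fin 2 → Type u} : Inv V → Proc
  | .read _ _ => .reader
  | .write _ _ => .writer

/-- The client at which a response occurs. -/
def Resp.client {V : Fin 2 → Type u} : Resp V → Proc
  | .values _ => .reader
  | .ok => .writer

/-- Messages with contents from an arbitrary alphabet `M`: read requests; messages carrying exactly
one value (one version) of the object `i`, possibly with further information; all other messages. -/
inductive Msg (V : Fin 2 → Type u) (M : Type u) : Type u
  | request (x : M)
  | value (i : Fin 2) (val : V i) (x : M)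
  | other (x : M)

/-- The ordered pairs of processes joined by a channel: every client and every server, and the two
servers, in both directions.  There are no channels between clients. -/
def Link : Proc → Proc → Prop
  | .reader, .server _ => True
  | .writer, .server _ => True
  | .server _, .reader => True
  | .server _, .writer => True
  | .server i, .server j => i ≠ j
  | _, _ => False

/-- The messages that may be sent from `p` to `q` over their channel.  Reads are carried out by
read requests and value messages, and servers send nothing else than value messages (for their own
object) to the reader. -/
def Carries {V : Fin 2 → Type u} {M : Type u} (p q : Proc) (m : Msg V M) : Prop :=
  Link p q ∧
    match p, q, m with
    | .reader, _, .request _ => True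
    | .server i, .reader, .value j _ _ => i = j
    | .server _, .reader, _ => False
    | _, _, .other _ => True
    | _, _, _ => False

/-- Actions: invocations and responses of transactions, `send(m)_{p,q}`, `recv(m)_{p,q}`, and
internal actions of the processes. -/
inductive Act (V : Fin 2 → Type u) (M : Type u) (I : Type u) : Type u
  | inv (x : Inv V)
  | resp (y : Resp V)
  | send (p q : Proc) (m : Msg V M)
  | recv (p q : Proc) (m : Msg V M)
  | internal (p : Proc) (x : I)

section

variable {V : Fin 2 → Type u} {M I : Type u}

/-- Input actions of the process `p`. -/
def procInput (p : Proc) : Set (Act V M I) :=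
  {a | (∃ x : Inv V, x.client = p ∧ a = .inv x) ∨ ∃ q m, Carries q p m ∧ a = .recv q p m}

/-- Output actions of the process `p`. -/
def procOutput (p : Proc) : Set (Act V M I) :=
  {a | (∃ y : Resp V, y.client = p ∧ a = .resp y) ∨ ∃ q m, Carries p q m ∧ a = .send p q m}

/-- Internal actions of the process `p`. -/
def procInternal (p : Proc) : Set (Act V M I) :=
  {a | ∃ x, a = .internal p x}

/-- The reliable asynchronous channel from `p` to `q`: its state is the multiset of the messages in
transit, which may be delivered in any order.  Each message has its own task, so that in a fair
execution every message is eventually delivered. -/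
def channel (V : Fin 2 → Type u) (M I : Type u) (p q : Proc) : IOAutomaton (Act V M I) where
  State := Multiset (Msg V M)
  input := {a | ∃ m, Carries p q m ∧ a = .send p q m}
  output := {a | ∃ m, Carries p q m ∧ a = .recv p q m}
  internal := ∅
  input_output := by
    rw [Set.disjoint_left]
    rintro a ⟨m, -, rfl⟩ ⟨m', -, h⟩
    cases h
  input_internal := Set.disjoint_empty _
  output_internal := Set.disjoint_empty _
  start := {0}
  start_nonempty := Set.singleton_nonempty _
  step s a s' := ∃ m, Carries p q m ∧
    ((a = .send p q m ∧ s' = m ::ₘ s) ∨ (a = .recv p q m ∧ s = m ::ₘ s'))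
  step_sig := by
    rintro s a s' ⟨m, hm, ⟨h, -⟩ | ⟨h, -⟩⟩
    · exact Or.inl (Or.inl ⟨m, hm, h⟩)
    · exact Or.inl (Or.inr ⟨m, hm, h⟩)
  input_enabled := by
    rintro s a ⟨m, hm, rfl⟩
    exact ⟨m ::ₘ s, m, hm, Or.inl ⟨rfl, rfl⟩⟩
  Task := {m : Msg V M // Carries p q m}
  task m := {.recv p q m.1}
  task_cover := by
    ext a
    constructor
    · intro h
      obtain ⟨m, rfl⟩ := Set.mem_iUnion.1 h
      exact Or.inl ⟨m.1, m.2, rfl⟩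
    · rintro (⟨m, hm, rfl⟩ | h)
      · exact Set.mem_iUnion.2 ⟨⟨m, hm⟩, rfl⟩
      · exact h.elim
  task_disjoint := by
    rintro ⟨m, hm⟩ ⟨m', hm'⟩ hne
    rw [Set.disjoint_singleton]
    intro h
    apply hne
    cases h
    rfl

end

/-- An algorithm: an alphabet of message contents, a set of names of internal actions, and for each
of the four processes an I/O automaton with the prescribed signature and with at most countably many
tasks. -/
structure Algorithm (V : Fin 2 → Type u) where
  M : Type u
  I : Type u
  proc : Proc → IOAutomaton (Act V M I)
  proc_input : ∀ p, (proc p).input = procInput p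
  proc_output : ∀ p, (proc p).output = procOutput p
  proc_internal : ∀ p, (proc p).internal = procInternal p
  countable_tasks : ∀ p, Countable (proc p).Task

namespace Algorithm

variable {V : Fin 2 → Type u}

/-- The automata of the system: the four processes and one channel for each link. -/
def component (A : Algorithm V) :
    Proc ⊕ {pq : Proc × Proc // Link pq.1 pq.2} → IOAutomaton (Act V A.M A.I)
  | .inl p => A.proc p
  | .inr c => channel V A.M A.I c.1.1 c.1.2

theorem compatible (A : Algorithm V) : IOAutomaton.Compatible A.component where
  internal_acts := by
    rintro (p | c) (q | ⟨⟨p', q'⟩, hc⟩) hne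
    · have hpq : p ≠ q := fun h => hne (by rw [h])
      simp only [component, IOAutomaton.acts, A.proc_input, A.proc_output, A.proc_internal]
      rw [Set.disjoint_left]
      rintro a ⟨x, rfl⟩ ((h | h) | ⟨y, h⟩)
      · rcases h with ⟨_, _, h⟩ | ⟨_, _, _, h⟩ <;> cases h
      · rcases h with ⟨_, _, h⟩ | ⟨_, _, _, h⟩ <;> cases h
      · cases h
        exact hpq rfl
    · simp only [component, IOAutomaton.acts, A.proc_internal, channel]
      rw [Set.disjoint_left]
      rintro a ⟨x, rfl⟩ ((⟨_, _, h⟩ | ⟨_, _, h⟩) | h)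
      · cases h
      · cases h
      · exact h
    · exact Set.empty_disjoint _
    · exact Set.empty_disjoint _
  output_output := by
    rintro (p | ⟨⟨p, q⟩, hc⟩) (p' | ⟨⟨p', q'⟩, hc'⟩) hne
    · have hpq : p ≠ p' := fun h => hne (by rw [h])
      simp only [component, A.proc_output]
      rw [Set.disjoint_left]
      rintro a (⟨y, hy, rfl⟩ | ⟨q, m, -, rfl⟩) (⟨y', hy', h⟩ | ⟨q', m', -, h⟩)
      · cases h
        exact hpq (hy.symm.trans hy')
      · cases h
      · cases h
      · cases h
        exact hpq rfl
    · simp only [component, A.proc_output, channel]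
      rw [Set.disjoint_left]
      rintro a (⟨y, hy, rfl⟩ | ⟨q, m, -, rfl⟩) ⟨m', -, h⟩ <;> cases h
    · simp only [component, A.proc_output, channel]
      rw [Set.disjoint_left]
      rintro a ⟨m', -, rfl⟩ (⟨y, hy, h⟩ | ⟨q, m, -, h⟩) <;> cases h
    · simp only [component, channel]
      rw [Set.disjoint_left]
      rintro a ⟨m, -, rfl⟩ ⟨m', -, h⟩
      cases h
      exact hne rfl

/-- The automaton of the whole system. -/
def system (A : Algorithm V) : IOAutomaton (Act V A.M A.I) :=
  IOAutomaton.compose A.component A.compatible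

end Algorithm

/-! ### Transactions in an execution

A transaction is identified with the position of its invocation. -/

section

variable {V : Fin 2 → Type u} {M I : Type u} {B : IOAutomaton (Act V M I)}

/-- The transaction `x` is invoked at position `n` and no response of its client occurs between the
positions `n` and `k`. -/
def PendingAt (α : B.Execution) (n : ℕ) (x : Inv V) (k : ℕ) : Prop :=
  n < k ∧ α.Occurs n (.inv x) ∧
    ∀ j, n < j → j < k → ∀ y : Resp V, y.client = x.client → ¬ α.Occurs j (.resp y)

/-- The transaction `x` invoked at position `n` responds at position `m` with `y`. -/
def RespondsAt (α : B.Execution) (n : ℕ) (x : Inv V) (m : ℕ) (y : Resp V) : Prop :=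
  PendingAt α n x m ∧ y.client = x.client ∧ α.Occurs m (.resp y)

/-- A complete transaction is invoked at position `n`. -/
def CompleteAt (α : B.Execution) (n : ℕ) : Prop :=
  ∃ x m y, RespondsAt α n x m y

/-- An incomplete transaction is invoked at position `n`. -/
def IncompleteAt (α : B.Execution) (n : ℕ) : Prop :=
  (∃ x, α.Occurs n (.inv x)) ∧ ¬ CompleteAt α n

/-- Each client invokes a transaction only when all its previous ones have completed. -/
def WellFormed (α : B.Execution) : Prop :=
  ∀ n k x x', n < k → α.Occurs n (.inv x) → α.Occurs k (.inv x') → x.client = x'.client →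
    ∃ m y, m < k ∧ RespondsAt α n x m y

/-- Strict serializability, with initial values `v₀`.  There are a set `Φ` of incomplete
transactions, responses `r` (the actual ones for the complete transactions), and serialization
points `pt`, located after the invocation and, for complete transactions, before the response, such
that the complete transactions and those in `Φ`, listed in the order of their serialization points
as `e 0, e 1, …`, form an execution of the sequential data type, with values `val 0, val 1, …` of
the objects. -/
def StrictlySerializable (v₀ : ∀ i, V i) (α : B.Execution) : Prop :=
  ∃ (Φ : Set ℕ) (r : ℕ → Resp V) (pt : ℕ → ℝ) (N : ℕ∞) (e : ℕ → ℕ) (val : ℕ → ∀ i, V i),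
    (∀ n ∈ Φ, IncompleteAt α n ∧ (n : ℝ) < pt n) ∧
    (∀ n x m y, RespondsAt α n x m y → r n = y ∧ (n : ℝ) < pt n ∧ pt n < (m : ℝ)) ∧
    Set.BijOn e {j : ℕ | (j : ℕ∞) < N} ({n | CompleteAt α n} ∪ Φ) ∧
    StrictMonoOn (fun j => pt (e j)) {j : ℕ | (j : ℕ∞) < N} ∧
    val 0 = v₀ ∧
    ∀ (j : ℕ) (x : Inv V), (j : ℕ∞) < N → α.act (e j) = .inv x →
      x.apply (val j) = (r (e j), val (j + 1))

/-- The reader sends a read request to server `i` at position `k`. -/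
def RequestSent (α : B.Execution) (i : Fin 2) (k : ℕ) : Prop :=
  ∃ x, α.Occurs k (.send .reader (.server i) (.request x))

/-- Server `i` receives a read request from the reader at position `k`. -/
def RequestReceived (α : B.Execution) (i : Fin 2) (k : ℕ) : Prop :=
  ∃ x, α.Occurs k (.recv .reader (.server i) (.request x))

/-- Server `i` sends a value of its object to the reader at position `k`. -/
def ValueSent (α : B.Execution) (i : Fin 2) (k : ℕ) : Prop :=
  ∃ val x, α.Occurs k (.send (.server i) .reader (.value i val x))

/-- One response per read, in an execution of the system. -/
structure OneRound (α : B.Execution) : Prop where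
  /-- A read request to server `i` is sent only as part of a pending `READ` of object `i`. -/
  request_pending : ∀ i k, RequestSent α i k →
    ∃ n S hS, i ∈ S ∧ PendingAt α n (.read S hS) k
  /-- At most one read request per object is sent in each `READ`. -/
  request_once : ∀ i k k', k < k' → RequestSent α i k → RequestSent α i k' →
    ∃ n S hS, k < n ∧ n < k' ∧ α.Occurs n (.inv (.read S hS))
  /-- A server sends a value to the reader only in response to a read request, and only once. -/
  value_once : ∀ i k, ValueSent α i k →
    ∃ j, j < k ∧ RequestReceived α i j ∧ ∀ l, j < l → l < k → ¬ ValueSent α i l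
  /-- A complete `READ` has carried out one round for each of its objects, and returns for each
  object the one value that it received from the server. -/
  round : ∀ n S hS m u, RespondsAt α n (.read S hS) m (.values u) → ∀ i ∈ S,
    ∃ a b c d x val x', n < a ∧ a < b ∧ b < c ∧ c < d ∧ d < m ∧
      α.Occurs a (.send .reader (.server i) (.request x)) ∧
      α.Occurs b (.recv .reader (.server i) (.request x)) ∧
      α.Occurs c (.send (.server i) .reader (.value i val x')) ∧
      α.Occurs d (.recv (.server i) .reader (.value i val x')) ∧
      u i = some val

end

/-! ### The SNOW properties -/

namespace Algorithm

variable {V : Fin 2 → Type u}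

/-- S: every well-formed fair execution is strictly serializable. -/
def PropertyS (A : Algorithm V) (v₀ : ∀ i, V i) : Prop :=
  ∀ α : A.system.Execution, α.Fair → WellFormed α → StrictlySerializable v₀ α

/-- N: in every fair execution of the automaton of server `i` in which a read request is received
and no other input action follows, the server eventually sends a value to the reader. -/
def PropertyN (A : Algorithm V) : Prop :=
  ∀ (i : Fin 2) (α : (A.proc (.server i)).Execution), α.Fair →
    ∀ k, RequestReceived α i k →
      (∀ j a, k < j → α.Occurs j a → a ∉ (A.proc (.server i)).input) →
      ∃ l, k < l ∧ ValueSent α i l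

/-- The reader issues the read requests of a `READ` without waiting for incoming messages: in every
well-formed fair execution of the automaton of the reader in which a `READ` is invoked and no other
input action follows, the read requests to all the servers concerned are eventually sent. -/
def IssuesRequests (A : Algorithm V) : Prop :=
  ∀ α : (A.proc .reader).Execution, α.Fair → WellFormed α →
    ∀ k S hS, α.Occurs k (.inv (.read S hS)) →
      (∀ j a, k < j → α.Occurs j a → a ∉ (A.proc .reader).input) →
      ∀ i ∈ S, ∃ l, k < l ∧ RequestSent α i l

/-- O: the read operations of a `READ` are issued without waiting for incoming messages, and each
takes one round in which the server responds with exactly one version. -/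
def PropertyO (A : Algorithm V) : Prop :=
  A.IssuesRequests ∧ ∀ α : A.system.Execution, α.Fair → WellFormed α → OneRound α

/-- W: transactions may be invoked at any time (being input actions), so that `WRITE`s may be
concurrent and conflict with `READ`s, and every `READ` and every `WRITE` eventually completes. -/
def PropertyW (A : Algorithm V) : Prop :=
  ∀ α : A.system.Execution, α.Fair → WellFormed α →
    ∀ n x, α.Occurs n (.inv x) → CompleteAt α n

/-- The SNOW properties, for objects with initial values `v₀`. -/
structure SNOW (A : Algorithm V) (v₀ : ∀ i, V i) : Prop where
  S : A.PropertyS v₀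
  N : A.PropertyN
  O : A.PropertyO
  W : A.PropertyW

end Algorithm

end Snow

/-!
Let `R` read both objects, and let `W` write values `w i ≠ v₀ i` to both.  By O and N the reader
issues its requests, and the servers answer them, without waiting for any further message.  So once
the requests of `R` are in transit, the values that `R` returns are answers that the two servers give
independently, each possible by the state of that server alone (`Answers`, `exists_answers`).
Playing these answers and extending to a fair execution, in which `R` completes by W, shows that
every pair of answers is subject to strict serializability (`answers_eq`): both are initial values or
both are written ones, both are initial if `W` has not been invoked, and both are written if `W` has
completed before `R` was invoked.

Consider a run `γ` in which `W` completes first (`exists_write_run`) and then the reader invokes `R`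
and sends its requests (`exists_reader_run`).  The reader receives nothing in `γ`, as servers send it
only values, and these only in response to requests.  Hence all actions of the reader can be moved to
the front (`Run.filter_append`, `swaps_system`), without changing the final state.  In the reordered
run, after the actions of the reader, `W` has not been invoked, so that the answers are the initial
values.  Each later step changes the state of at most one server; the answer of the other one remains
initial, and since the two must agree in kind, so does the answer of the server that moved.  Thus
the answers are the initial values in the final state as well, whereas, by `γ`, they must be the
written ones.

The extension of finite runs to fair executions (`Run.exists_fair_execution`) uses that only countably
many tasks are enabled in each state.
-/

namespace Snow

namespace IOAutomaton

variable {Act : Type u}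

/-! ### Finite runs and fair continuations -/

/-- `B.Run s l s'`: the automaton `B` can go from the state `s` to the state `s'` by performing the
actions of the list `l` in order.  The state `s` need not be a start state. -/
inductive Run (B : IOAutomaton Act) : B.State → List Act → B.State → Prop
  | nil (s) : Run B s [] s
  | cons {s a s₁ l s₂} : B.step s a s₁ → Run B s₁ l s₂ → Run B s (a :: l) s₂

variable {B : IOAutomaton Act}

theorem Run.append {s l s₁ l' s₂} (h : B.Run s l s₁) (h' : B.Run s₁ l' s₂) :
    B.Run s (l ++ l') s₂ := by
  induction h with
  | nil => exact h'
  | cons hs _ ih => exact .cons hs (ih h')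

theorem Run.of_append {s l l' s₂} (h : B.Run s (l ++ l') s₂) :
    ∃ s₁, B.Run s l s₁ ∧ B.Run s₁ l' s₂ := by
  induction l generalizing s with
  | nil => exact ⟨s, .nil s, h⟩
  | cons a l ih =>
    cases h with
    | cons hs hr =>
      obtain ⟨s₁, h₁, h₂⟩ := ih hr
      exact ⟨s₁, .cons hs h₁, h₂⟩

theorem Run.single {s a s₁} (h : B.step s a s₁) : B.Run s [a] s₁ := .cons h (.nil _)

/-- The actions of an execution between the positions `k` and `k + n`, as a finite run. -/
theorem Execution.run (α : B.Execution) (k n : ℕ) (h : ((k + n : ℕ) : ℕ∞) ≤ α.len) :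
    B.Run (α.st k) ((List.range' k n).map α.act) (α.st (k + n)) := by
  induction n generalizing k with
  | zero => exact .nil _
  | succ n ih =>
    have h' := ih (k + 1) (by rwa [show k + 1 + n = k + (n + 1) by omega])
    rw [show k + 1 + n = k + (n + 1) by omega] at h'
    refine .cons (α.st_succ k (lt_of_lt_of_le ?_ h)) h'
    exact_mod_cast (by omega : k < k + (n + 1))

/-- A fair continuation from the state `s`, without input actions. -/
theorem exists_fair_continuation [Nonempty Act] (hc : ∀ s, {t | B.TaskEnabled t s}.Countable)
    (s : B.State) :
    ∃ (len : ℕ∞) (st : ℕ → B.State) (act : ℕ → Act), st 0 = s ∧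
      (∀ n : ℕ, (n : ℕ∞) < len → B.step (st n) (act n) (st (n + 1))) ∧
      (∀ n : ℕ, (n : ℕ∞) < len → act n ∉ B.input) ∧
      ∀ t : B.Task, (∀ N : ℕ, len = N → ¬ B.TaskEnabled t (st N)) ∧
        (len = ⊤ → {n | act n ∈ B.task t}.Infinite ∨ {n | ¬ B.TaskEnabled t (st n)}.Infinite) := by
  classical
  -- `E s` enumerates the tasks that are enabled in `s`.
  have hE : ∀ s, ∃ f : ℕ → Option B.Task, ∀ t, B.TaskEnabled t s → ∃ n, f n = some t := by
    intro s
    let := (hc s).toEncodable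
    refine ⟨fun n => (Encodable.decode (α := {t | B.TaskEnabled t s}) n).map Subtype.val,
      fun t ht => ⟨Encodable.encode (⟨t, ht⟩ : {t | B.TaskEnabled t s}), ?_⟩⟩
    simp [Encodable.encodek]
  choose E hE using hE
  -- One step: the requested task if it is enabled, and otherwise any enabled task.
  have hnext : ∀ (s : B.State) (o : Option B.Task), ∃ p : Act × B.State,
      (∃ t, B.TaskEnabled t s) → (∃ t, p.1 ∈ B.task t) ∧ B.step s p.1 p.2 ∧
        ∀ t, o = some t → B.TaskEnabled t s → p.1 ∈ B.task t := by
    intro s o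
    by_cases h : ∃ t, o = some t ∧ B.TaskEnabled t s
    · obtain ⟨t, rfl, a, ha, s', hs⟩ := h
      exact ⟨(a, s'), fun _ => ⟨⟨t, ha⟩, hs, fun t' h _ => by cases h; exact ha⟩⟩
    · by_cases h' : ∃ t, B.TaskEnabled t s
      · obtain ⟨t, a, ha, s', hs⟩ := h'
        exact ⟨(a, s'), fun _ => ⟨⟨t, ha⟩, hs, fun t' h₁ h₂ => (h ⟨t', h₁, h₂⟩).elim⟩⟩
      · exact ⟨(Classical.arbitrary Act, s), fun h => (h' h).elim⟩
  choose next hnext using hnext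
  -- `hist n` records the states up to time `n`.  At time `n = Nat.pair a b` the `b`-th task of those
  -- enabled at time `a ≤ n` is requested, so that a task enabled at all times from some time on is
  -- performed infinitely often.
  let hist : ℕ → ℕ → B.State := fun n => Nat.rec (fun _ => s) (fun n h =>
    Function.update h (n + 1) (next (h n) (E (h n.unpair.1) n.unpair.2)).2) n
  have hist_succ : ∀ n, hist (n + 1) = Function.update (hist n) (n + 1)
    (next (hist n n) (E (hist n n.unpair.1) n.unpair.2)).2 := fun n => rfl
  have hist_eq : ∀ n a, a ≤ n → hist n a = hist a a := by
    intro n a h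
    induction n, h using Nat.le_induction with
    | base => rfl
    | succ n h ih => rw [hist_succ, Function.update_of_ne (by omega), ih]
  let st : ℕ → B.State := fun n => hist n n
  let req : ℕ → Option B.Task := fun n => E (st n.unpair.1) n.unpair.2
  let act : ℕ → Act := fun n => (next (st n) (req n)).1
  have st_succ : ∀ n, st (n + 1) = (next (st n) (req n)).2 := by
    intro n
    change hist (n + 1) (n + 1) = _
    rw [hist_succ, Function.update_self, hist_eq n _ (Nat.unpair_left_le n)]
  let len : ℕ∞ := if h : ∃ n, ¬ ∃ t, B.TaskEnabled t (st n) then (Nat.find h : ℕ) else ⊤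
  have hlt : ∀ n : ℕ, (n : ℕ∞) < len → ∃ t, B.TaskEnabled t (st n) := by
    intro n hn
    by_contra hcon
    have hex : ∃ n, ¬ ∃ t, B.TaskEnabled t (st n) := ⟨n, hcon⟩
    have hlen : len = (Nat.find hex : ℕ) := dif_pos hex
    rw [hlen, Nat.cast_lt] at hn
    exact Nat.find_min hex hn hcon
  refine ⟨len, st, act, rfl, fun n hn => ?_, fun n hn => ?_,
    fun t => ⟨fun N hN => ?_, fun hlen => ?_⟩⟩
  · rw [st_succ]
    exact (hnext (st n) (req n) (hlt n hn)).2.1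
  · obtain ⟨t, ht⟩ := (hnext (st n) (req n) (hlt n hn)).1
    have : act n ∈ B.output ∪ B.internal := by
      rw [← B.task_cover]
      exact Set.mem_iUnion.2 ⟨t, ht⟩
    intro hin
    rcases this with h | h
    · exact Set.disjoint_left.1 B.input_output hin h
    · exact Set.disjoint_left.1 B.input_internal hin h
  · by_cases hex : ∃ n, ¬ ∃ t, B.TaskEnabled t (st n)
    · have hlen : len = (Nat.find hex : ℕ) := dif_pos hex
      rw [hlen, Nat.cast_inj] at hN
      intro ht
      exact Nat.find_spec hex ⟨t, hN ▸ ht⟩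
    · have hlen : len = ⊤ := dif_neg hex
      rw [hlen] at hN
      exact (ENat.top_ne_natCast N hN).elim
  · by_contra hcon
    rw [not_or, Set.not_infinite, Set.not_infinite] at hcon
    obtain ⟨hfa, hfe⟩ := hcon
    obtain ⟨N₁, hN₁⟩ := hfa.bddAbove
    obtain ⟨N₂, hN₂⟩ := hfe.bddAbove
    have hen : ∀ n, N₂ < n → B.TaskEnabled t (st n) := fun n hn => by
      by_contra h
      exact absurd (hN₂ h) (by omega)
    obtain ⟨b, hb⟩ := hE (st (max N₁ N₂ + 1)) t
      (hen (max N₁ N₂ + 1) (by omega))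
    have hle : max N₁ N₂ + 1 ≤ Nat.pair (max N₁ N₂ + 1) b := Nat.left_le_pair _ _
    have hreq : req (Nat.pair (max N₁ N₂ + 1) b) = some t := by
      simp only [req, Nat.unpair_pair, hb]
    have hmem := (hnext (st _) (req (Nat.pair (max N₁ N₂ + 1) b))
      (hlt (Nat.pair (max N₁ N₂ + 1) b) (by rw [hlen]; exact ENat.natCast_lt_top _))).2.2 t hreq
      (hen (Nat.pair (max N₁ N₂ + 1) b) (by omega))
    exact absurd (hN₁ hmem) (by omega)

/-- Every finite run from a start state extends to a fair execution that contains no input actions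
after the run, provided that only countably many tasks are enabled in each state. -/
theorem Run.exists_fair_execution [Nonempty Act] (hc : ∀ s, {t | B.TaskEnabled t s}.Countable)
    {s l s'} (h : B.Run s l s') (hs : s ∈ B.start) :
    ∃ α : B.Execution, α.Fair ∧ α.st 0 = s ∧ α.st l.length = s' ∧
      (∀ n (hn : n < l.length), α.Occurs n l[n]) ∧
      ∀ n a, l.length ≤ n → α.Occurs n a → a ∉ B.input := by
  -- Without the condition on the start state, the claim is proved by induction on the run.
  have key : ∃ (len : ℕ∞) (st : ℕ → B.State) (act : ℕ → Act), st 0 = s ∧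
      (∀ n : ℕ, (n : ℕ∞) < len → B.step (st n) (act n) (st (n + 1))) ∧
      (∀ t : B.Task, (∀ N : ℕ, len = N → ¬ B.TaskEnabled t (st N)) ∧
        (len = ⊤ → {n | act n ∈ B.task t}.Infinite ∨ {n | ¬ B.TaskEnabled t (st n)}.Infinite)) ∧
      st l.length = s' ∧ (∀ n (hn : n < l.length), (n : ℕ∞) < len ∧ act n = l[n]) ∧
      ∀ n, l.length ≤ n → (n : ℕ∞) < len → act n ∉ B.input := by
    clear hs
    induction h with
    | nil s =>
      obtain ⟨len, st, act, h0, hst, hin, hf⟩ := exists_fair_continuation hc s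
      exact ⟨len, st, act, h0, hst, hf, h0, fun n hn => absurd hn (Nat.not_lt_zero n),
        fun n _ hn => hin n hn⟩
    | @cons s a s₁ l s₂ hs _ ih =>
      obtain ⟨len, st, act, h0, hst, hf, hl, hpre, hin⟩ := ih
      have hlt : ∀ n : ℕ, ((n + 1 : ℕ) : ℕ∞) < len + 1 → (n : ℕ∞) < len := fun n hn => by
        rw [Nat.cast_add, Nat.cast_one] at hn
        exact lt_of_add_lt_add_right hn
      have hlt' : ∀ n : ℕ, (n : ℕ∞) < len → ((n + 1 : ℕ) : ℕ∞) < len + 1 := fun n hn => by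
        rw [Nat.cast_add, Nat.cast_one]
        exact (ENat.add_lt_add_iff_right (by simp)).2 hn
      refine ⟨len + 1, fun n => Nat.casesOn n s st, fun n => Nat.casesOn n a act, rfl, ?_, ?_, hl,
        ?_, ?_⟩
      · rintro (_ | n) hn
        · simpa [h0] using hs
        · exact hst n (hlt n hn)
      · intro t
        refine ⟨?_, fun htop => ?_⟩
        · rintro (_ | N) hN
          · simp at hN
          · refine (hf t).1 N ?_
            have hne : len ≠ ⊤ := by
              rintro rfl
              exact ENat.natCast_ne_top (N + 1) (by rw [← hN]; rfl)
            lift len to ℕ using hne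
            have : len + 1 = N + 1 := by exact_mod_cast hN
            exact_mod_cast Nat.succ.inj this
        · have hlen : len = ⊤ := by
            by_contra hne
            lift len to ℕ using hne
            exact ENat.natCast_ne_top (len + 1) (by exact_mod_cast htop)
          refine ((hf t).2 hlen).imp (fun h => ?_) (fun h => ?_)
          · exact (h.image (Nat.succ_injective.injOn)).mono (by rintro _ ⟨n, hn, rfl⟩; exact hn)
          · exact (h.image (Nat.succ_injective.injOn)).mono (by rintro _ ⟨n, hn, rfl⟩; exact hn)
      · rintro (_ | n) hn
        · exact ⟨by simp, rfl⟩
        · have := hpre n (by simpa using hn)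
          exact ⟨hlt' n this.1, this.2⟩
      · rintro (_ | n) hn hn'
        · simp at hn
        · exact hin n (by simpa using hn) (hlt n hn')
  obtain ⟨len, st, act, h0, hst, hf, hl, hpre, hin⟩ := key
  exact ⟨⟨len, st, act, h0 ▸ hs, hst⟩, hf, h0, hl, hpre, fun n a hn ha => ha.2 ▸ hin n hn ha.1⟩

/-! ### Reordering runs -/

/-- Two consecutive steps with actions `a`, `b` can always be performed in the order `b`, `a`. -/
def Swaps (B : IOAutomaton Act) (a b : Act) : Prop :=
  ∀ s s₁ s₂, B.step s a s₁ → B.step s₁ b s₂ → ∃ s₁', B.step s b s₁' ∧ B.step s₁' a s₂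

theorem Run.move_right {s a l l' s'} (hl : ∀ b ∈ l, B.Swaps a b) (h : B.Run s (a :: (l ++ l')) s') :
    B.Run s (l ++ a :: l') s' := by
  induction l generalizing s with
  | nil => exact h
  | cons b l ih =>
    cases h with
    | cons h₁ h =>
      cases h with
      | cons h₂ h =>
        obtain ⟨s₁, h₁', h₂'⟩ := hl b (by simp) _ _ _ h₁ h₂
        exact .cons h₁' (ih (fun c hc => hl c (by simp [hc])) (.cons h₂' h))

/-- The actions of a set `P` can be performed first, if each of them can be moved before each action
outside `P`. -/
theorem Run.filter_append {s l s'} (P : Act → Bool)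
    (hP : ∀ a ∈ l, ∀ b ∈ l, P a = false → P b = true → B.Swaps a b) (h : B.Run s l s') :
    B.Run s (l.filter P ++ l.filter (fun a => !P a)) s' := by
  induction h with
  | nil => exact .nil _
  | @cons s a s₁ l s₂ hs _ ih =>
    have h := Run.cons hs (ih fun a ha b hb => hP a (by simp [ha]) b (by simp [hb]))
    cases ha : P a with
    | true => simpa [ha] using h
    | false =>
      have := h.move_right fun b hb => hP a (by simp) b
        (by simp [List.mem_of_mem_filter hb]) ha (List.mem_filter.1 hb).2
      simpa [ha] using this

/-! ### Steps of a composition -/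

section compose

variable {ι : Type} {C : ι → IOAutomaton Act} {hC : Compatible C}

open Classical in
theorem Run.component {s l s'} (h : (compose C hC).Run s l s') (i : ι) :
    (C i).Run (s i) (l.filter (· ∈ (C i).acts)) (s' i) := by
  induction h with
  | nil => exact .nil _
  | @cons s a s₁ l s₂ hs _ ih =>
    by_cases ha : a ∈ (C i).acts
    · rw [List.filter_cons_of_pos (by simpa using ha)]
      exact .cons ((hs.2 i).1 ha) ih
    · rw [List.filter_cons_of_neg (by simpa using ha), ← (hs.2 i).2 ha]
      exact ih

/-- A step of the component `j` is a step of the composition, if its action can be performed by all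
the components concerned. -/
theorem exists_compose_step {s : ∀ i, (C i).State} {a : Act} {j : ι} {x : (C j).State}
    (hj : a ∈ (C j).acts) (hx : (C j).step (s j) a x)
    (h : ∀ i, i ≠ j → a ∈ (C i).acts → ∃ y, (C i).step (s i) a y) :
    ∃ s', (compose C hC).step s a s' ∧ s' j = x ∧ ∀ i, a ∉ (C i).acts → s' i = s i := by
  have key : ∀ i, ∃ y, (a ∈ (C i).acts → (C i).step (s i) a y) ∧ (a ∉ (C i).acts → y = s i) ∧
      ∀ e : i = j, e ▸ y = x := by
    intro i
    by_cases hij : i = j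
    · subst hij
      exact ⟨x, fun _ => hx, fun hn => (hn hj).elim, fun _ => rfl⟩
    · by_cases ha : a ∈ (C i).acts
      · obtain ⟨y, hy⟩ := h i hij ha
        exact ⟨y, fun _ => hy, fun hn => (hn ha).elim, fun e => (hij e).elim⟩
      · exact ⟨s i, fun hn => (ha hn).elim, fun _ => rfl, fun e => (hij e).elim⟩
  choose s' h₁ h₂ h₃ using key
  exact ⟨s', ⟨⟨j, hj⟩, fun i => ⟨h₁ i, h₂ i⟩⟩, h₃ j rfl, h₂⟩

/-- Two actions can be swapped in a composition, if they can be swapped in all the components that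
have both. -/
theorem swaps_compose {a b : Act}
    (h : ∀ i, a ∈ (C i).acts → b ∈ (C i).acts → (C i).Swaps a b) : (compose C hC).Swaps a b := by
  intro s s₁ s₂ ha hb
  have key : ∀ i, ∃ y, ((b ∈ (C i).acts → (C i).step (s i) b y) ∧ (b ∉ (C i).acts → y = s i)) ∧
      (a ∈ (C i).acts → (C i).step y a (s₂ i)) ∧ (a ∉ (C i).acts → s₂ i = y) := by
    intro i
    have ha' := ha.2 i
    have hb' := hb.2 i
    by_cases h₁ : a ∈ (C i).acts <;> by_cases h₂ : b ∈ (C i).acts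
    · obtain ⟨y, hy₁, hy₂⟩ := h i h₁ h₂ _ _ _ (ha'.1 h₁) (hb'.1 h₂)
      exact ⟨y, ⟨fun _ => hy₁, fun hn => (hn h₂).elim⟩, fun _ => hy₂, fun hn => (hn h₁).elim⟩
    · exact ⟨s i, ⟨fun hn => (h₂ hn).elim, fun _ => rfl⟩, fun _ => hb'.2 h₂ ▸ ha'.1 h₁,
        fun hn => (hn h₁).elim⟩
    · exact ⟨s₂ i, ⟨fun _ => ha'.2 h₁ ▸ hb'.1 h₂, fun hn => (hn h₂).elim⟩, fun hn => (h₁ hn).elim,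
        fun _ => rfl⟩
    · exact ⟨s i, ⟨fun hn => (h₂ hn).elim, fun _ => rfl⟩, fun hn => (h₁ hn).elim,
        fun _ => (hb'.2 h₂).trans (ha'.2 h₁)⟩
  choose y hy₁ hy₂ using key
  exact ⟨y, ⟨hb.1, hy₁⟩, ha.1, hy₂⟩

end compose

end IOAutomaton

open IOAutomaton

/-! ### Processes and actions -/

instance : Countable Proc :=
  Function.Injective.countable (β := ℕ)
    (f := fun | .reader => 0 | .writer => 1 | .server i => 2 + i.val) (by
      rintro (_ | _ | i) (_ | _ | j) h <;> simp at h <;> first | rfl | omega | skip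
      exact congrArg _ (Fin.ext h))

section

variable {V : Fin 2 → Type u} {M I : Type u}

instance : Nonempty (Act V M I) := ⟨.resp .ok⟩

/-- The action `a` is not the receipt of a message. -/
def Act.NotRecv (a : Act V M I) : Prop := ∀ p q m, a ≠ .recv p q m

end

namespace Algorithm

variable {V : Fin 2 → Type u} (A : Algorithm V)

/-! ### States and steps of the system -/

/-- The state of the process `p` in a state of the system. -/
def loc (s : A.system.State) (p : Proc) : (A.proc p).State := s (.inl p)

/-- The messages in transit from `p` to `q` in a state of the system. -/
def chan (s : A.system.State) (p q : Proc) (h : Link p q) : Multiset (Msg V A.M) :=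
  s (.inr ⟨(p, q), h⟩)

variable {A}

theorem mem_acts_proc {p : Proc} {a : Act V A.M A.I} :
    a ∈ (A.proc p).acts ↔ a ∈ procInput p ∨ a ∈ procOutput p ∨ a ∈ procInternal p := by
  rw [IOAutomaton.acts, A.proc_input, A.proc_output, A.proc_internal, Set.mem_union, Set.mem_union,
    or_assoc]

theorem mem_acts_proc_of_step {p : Proc} {x y} {a : Act V A.M A.I} (h : (A.proc p).step x a y) :
    a ∈ (A.proc p).acts := (A.proc p).step_sig _ _ _ h

/-- An action is an action of at most one process. -/
theorem eq_of_mem_acts_proc {p q : Proc} {a : Act V A.M A.I} (hp : a ∈ (A.proc p).acts)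
    (hq : a ∈ (A.proc q).acts) : p = q := by
  rw [mem_acts_proc] at hp hq
  rcases hp with (⟨x, rfl, rfl⟩ | ⟨q', m, -, rfl⟩) | (⟨x, rfl, rfl⟩ | ⟨q', m, -, rfl⟩) | ⟨x, rfl⟩ <;>
  rcases hq with (⟨x, hx, h⟩ | ⟨q', m, -, h⟩) | (⟨x, hx, h⟩ | ⟨q', m, -, h⟩) | ⟨x, h⟩ <;>
  cases h <;> first | rfl | exact hx

theorem inv_mem_input (x : Inv V) : (.inv x : Act V A.M A.I) ∈ A.system.input := by
  refine ⟨Set.mem_iUnion.2 ⟨.inl x.client, ?_⟩, fun h => ?_⟩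
  · change _ ∈ (A.proc _).input
    rw [A.proc_input]
    exact Or.inl ⟨x, rfl, rfl⟩
  · obtain ⟨p | c, h⟩ := Set.mem_iUnion.1 h
    · change _ ∈ (A.proc _).output at h
      rw [A.proc_output] at h
      rcases h with ⟨_, _, h⟩ | ⟨_, _, _, h⟩ <;> cases h
    · obtain ⟨_, _, h⟩ := h
      cases h

theorem step_loc_eq {s a s'} (h : A.system.step s a s') {p : Proc} (ha : a ∉ (A.proc p).acts) :
    A.loc s' p = A.loc s p := (h.2 (.inl p)).2 ha

theorem carries_of_mem_acts {p q r : Proc} {m : Msg V A.M} :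
    ((.send q r m : Act V A.M A.I) ∈ (A.proc p).acts → Carries q r m) ∧
      ((.recv q r m : Act V A.M A.I) ∈ (A.proc p).acts → Carries q r m) := by
  constructor <;> intro h <;> rw [mem_acts_proc] at h <;>
  rcases h with (⟨x, hx, h⟩ | ⟨q', m, hm, h⟩) | (⟨x, hx, h⟩ | ⟨q', m, hm, h⟩) | ⟨x, h⟩ <;>
  cases h <;> exact hm

theorem carries_of_step_send {s s' p q} {m : Msg V A.M} (h : A.system.step s (.send p q m) s') :
    Carries p q m := by
  obtain ⟨p' | c, hi⟩ := h.1
  · exact (carries_of_mem_acts (A := A) (p := p')).1 hi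
  · rcases hi with (⟨m', hm, h⟩ | ⟨m', hm, h⟩) | h
    · cases h; exact hm
    · cases h
    · exact h.elim

theorem carries_of_step_recv {s s' p q} {m : Msg V A.M} (h : A.system.step s (.recv p q m) s') :
    Carries p q m := by
  obtain ⟨p' | c, hi⟩ := h.1
  · exact (carries_of_mem_acts (A := A) (p := p')).2 hi
  · rcases hi with (⟨m', hm, h⟩ | ⟨m', hm, h⟩) | h
    · cases h
    · cases h; exact hm
    · exact h.elim

theorem step_chan_send {s s' p q} {m : Msg V A.M} (h : A.system.step s (.send p q m) s')
    (hpq : Link p q) : A.chan s' p q hpq = m ::ₘ A.chan s p q hpq := by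
  have hc := carries_of_step_send h
  obtain ⟨m', -, ⟨h', hs⟩ | ⟨h', hs⟩⟩ :=
    (h.2 (.inr ⟨(p, q), hpq⟩)).1 (Or.inl (Or.inl ⟨m, hc, rfl⟩))
  · cases h'; exact hs
  · cases h'

theorem step_chan_recv {s s' p q} {m : Msg V A.M} (h : A.system.step s (.recv p q m) s')
    (hpq : Link p q) : A.chan s p q hpq = m ::ₘ A.chan s' p q hpq := by
  have hc := carries_of_step_recv h
  obtain ⟨m', -, ⟨h', hs⟩ | ⟨h', hs⟩⟩ :=
    (h.2 (.inr ⟨(p, q), hpq⟩)).1 (Or.inl (Or.inr ⟨m, hc, rfl⟩))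
  · cases h'
  · cases h'; exact hs

theorem step_chan_eq {s a s' p q} (h : A.system.step s a s') (hpq : Link p q)
    (hs : ∀ m, a ≠ .send p q m) (hr : ∀ m, a ≠ .recv p q m) :
    A.chan s' p q hpq = A.chan s p q hpq := by
  refine (h.2 (.inr ⟨(p, q), hpq⟩)).2 ?_
  rintro ((⟨m', hm, h⟩ | ⟨m', hm, h⟩) | h)
  · exact hs _ h
  · exact hr _ h
  · exact h

/-- A step of a process other than the receipt of a message is a step of the system, which changes
only the process and the channels that leave it. -/
theorem exists_step_of_notRecv {s : A.system.State} {p : Proc} {a x} (ha : a.NotRecv)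
    (hx : (A.proc p).step (A.loc s p) a x) :
    ∃ s', A.system.step s a s' ∧ A.loc s' p = x ∧ (∀ q, q ≠ p → A.loc s' q = A.loc s q) ∧
      ∀ q r h, q ≠ p → A.chan s' q r h = A.chan s q r h := by
  have hp := mem_acts_proc_of_step hx
  obtain ⟨s', h, hs, hn⟩ := exists_compose_step (C := A.component) (hC := A.compatible) (s := s)
    (j := .inl p) hp hx (by
      rintro (q | c) hq hqa
      · exact (hq (congrArg _ (eq_of_mem_acts_proc hqa hp))).elim
      · rcases hqa with (h | ⟨m, hm, h⟩) | h
        · exact (A.component (.inr c)).input_enabled _ _ h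
        · exact (ha _ _ _ h).elim
        · exact h.elim)
  refine ⟨s', h, hs, fun q hq => hn (.inl q) fun hqa => hq (eq_of_mem_acts_proc hqa hp),
    fun q r hl hq => hn (.inr ⟨(q, r), hl⟩) ?_⟩
  rintro ((⟨m, hm, rfl⟩ | ⟨m, hm, h⟩) | h)
  · rw [mem_acts_proc] at hp
    rcases hp with (⟨x, hx, h⟩ | ⟨q', m, hm, h⟩) | (⟨x, hx, h⟩ | ⟨q', m, hm, h⟩) | ⟨x, h⟩ <;> cases h
    exact hq rfl
  · exact ha _ _ _ h
  · exact h

theorem exists_run_of_notRecv {s : A.system.State} {p : Proc} {l x y} (hx : A.loc s p = x)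
    (h : (A.proc p).Run x l y) (hl : ∀ a ∈ l, a.NotRecv) :
    ∃ s', A.system.Run s l s' ∧ A.loc s' p = y ∧ (∀ q, q ≠ p → A.loc s' q = A.loc s q) ∧
      ∀ q r h, q ≠ p → A.chan s' q r h = A.chan s q r h := by
  induction h generalizing s with
  | nil => exact ⟨s, .nil _, hx, fun _ _ => rfl, fun _ _ _ _ => rfl⟩
  | cons hs _ ih =>
    subst hx
    obtain ⟨s₁, h₁, hx₁, hl₁, hc₁⟩ := exists_step_of_notRecv (hl _ (by simp)) hs
    obtain ⟨s₂, h₂, hx₂, hl₂, hc₂⟩ := ih hx₁ fun a ha => hl a (by simp [ha])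
    exact ⟨s₂, .cons h₁ h₂, hx₂, fun q hq => (hl₂ q hq).trans (hl₁ q hq),
      fun q r h hq => (hc₂ q r h hq).trans (hc₁ q r h hq)⟩

/-- A process can receive any message that is in transit to it. -/
theorem exists_step_recv {s : A.system.State} {p q : Proc} {m x} (hm : Carries q p m)
    (hmem : m ∈ A.chan s q p hm.1) (hx : (A.proc p).step (A.loc s p) (.recv q p m) x) :
    ∃ s', A.system.step s (.recv q p m) s' ∧ A.loc s' p = x ∧
      (∀ r, r ≠ p → A.loc s' r = A.loc s r) ∧
      ∀ r t h, t ≠ p → A.chan s' r t h = A.chan s r t h := by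
  have hp := mem_acts_proc_of_step hx
  obtain ⟨s', h, hs, hn⟩ := exists_compose_step (C := A.component) (hC := A.compatible) (s := s)
    (j := .inl p) hp hx (by
      rintro (r | ⟨⟨r, t⟩, hl⟩) hq hqa
      · exact (hq (congrArg _ (eq_of_mem_acts_proc hqa hp))).elim
      · rcases hqa with (⟨m', hm', h⟩ | ⟨m', hm', h⟩) | h
        · cases h
        · cases h
          obtain ⟨c, hc⟩ := Multiset.exists_cons_of_mem hmem
          exact ⟨c, m, hm, Or.inr ⟨rfl, hc⟩⟩
        · exact h.elim)
  refine ⟨s', h, hs, fun q hq => hn (.inl q) fun hqa => hq (eq_of_mem_acts_proc hqa hp),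
    fun r t hl hq => hn (.inr ⟨(r, t), hl⟩) ?_⟩
  rintro ((⟨m, hm, h⟩ | ⟨m, hm, h⟩) | h)
  · cases h
  · cases h
    exact hq rfl
  · exact h

theorem mem_chan_of_run {s l s' p q} (hpq : Link p q) {m : Msg V A.M} (h : A.system.Run s l s')
    (hl : ∀ a ∈ l, a ≠ .recv p q m) (hm : m ∈ A.chan s p q hpq ∨ .send p q m ∈ l) :
    m ∈ A.chan s' p q hpq := by
  induction h with
  | nil => exact hm.resolve_right (by simp)
  | @cons s a s₁ l s₂ hs _ ih =>
    refine ih (fun b hb => hl b (by simp [hb])) ?_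
    by_cases ha : .send p q m = a
    · subst ha
      rw [step_chan_send hs hpq]
      exact Or.inl (Multiset.mem_cons_self _ _)
    · rcases hm with hm | hm
      · left
        by_cases h₁ : ∃ m', a = .send p q m'
        · obtain ⟨m', rfl⟩ := h₁
          rw [step_chan_send hs hpq]
          exact Multiset.mem_cons_of_mem hm
        · by_cases h₂ : ∃ m', a = .recv p q m'
          · obtain ⟨m', rfl⟩ := h₂
            rw [step_chan_recv hs hpq, Multiset.mem_cons] at hm
            refine hm.resolve_left ?_
            rintro rfl
            exact hl _ (by simp) rfl
          · rw [step_chan_eq hs hpq (fun m h => h₁ ⟨m, h⟩) (fun m h => h₂ ⟨m, h⟩)]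
            exact hm
      · exact Or.inr (by simpa [ha] using hm)

/-- A step of a process other than the receipt of a message can be moved before any action that does
not involve the process. -/
theorem swaps_system {p : Proc} {a b : Act V A.M A.I} (ha : a ∉ (A.proc p).acts)
    (hb : b ∈ (A.proc p).acts) (hb' : b.NotRecv) : A.system.Swaps a b := by
  refine swaps_compose ?_
  rintro (q | c) h₁ h₂
  · obtain rfl := eq_of_mem_acts_proc hb h₂
    exact (ha h₁).elim
  · rintro s s₁ s₂ ⟨m, hm, h⟩ ⟨m', hm', ⟨rfl, rfl⟩ | ⟨rfl, h'⟩⟩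
    · refine ⟨m' ::ₘ s, ⟨m', hm', Or.inl ⟨rfl, rfl⟩⟩, m, hm, ?_⟩
      rcases h with ⟨rfl, rfl⟩ | ⟨rfl, rfl⟩
      · exact Or.inl ⟨rfl, Multiset.cons_swap _ _ _⟩
      · exact Or.inr ⟨rfl, Multiset.cons_swap _ _ _⟩
    · exact (hb' _ _ _ rfl).elim

/-! ### Fair executions of the system and its processes -/

theorem countable_enabled_proc (p : Proc) (x : (A.proc p).State) :
    {t | (A.proc p).TaskEnabled t x}.Countable :=
  have := A.countable_tasks p
  Set.to_countable _

/-- Only finitely many messages are in transit, so that, in spite of the possibly uncountable message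
alphabet, only countably many tasks are enabled in each state. -/
theorem countable_enabled_system (s : A.system.State) :
    {t | A.system.TaskEnabled t s}.Countable := by
  have key : ∀ i, {t : (A.component i).Task | (A.component i).TaskEnabled t (s i)}.Countable := by
    rintro (p | c)
    · exact countable_enabled_proc p (s (.inl p))
    · have hfin : {m : Msg V A.M | m ∈ A.chan s c.1.1 c.1.2 c.2}.Finite :=
        Multiset.finite_toSet _
      refine ((hfin.preimage (f := fun t : {m : Msg V A.M // Carries c.1.1 c.1.2 m} => t.1)
        Subtype.val_injective.injOn).countable).mono ?_
      rintro ⟨m, hm⟩ ⟨a, rfl, s', m', hm', ⟨h, -⟩ | ⟨h, hs⟩⟩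
      · cases h
      · cases h
        exact (congrArg (m ∈ ·) hs).mpr (Multiset.mem_cons_self (α := Msg V A.M) _ _)
  refine (Set.countable_iUnion fun i =>
    (key i).image (Sigma.mk (β := fun i => (A.component i).Task) i)).mono ?_
  rintro ⟨i, t⟩ ⟨a, ha, s', hs⟩
  refine Set.mem_iUnion.2 ⟨i, t, ⟨a, ha, s' i, (hs.2 i).1 ?_⟩, rfl⟩
  have h : a ∈ (A.component i).output ∪ (A.component i).internal := by
    rw [← (A.component i).task_cover]
    exact Set.mem_iUnion.2 ⟨t, ha⟩
  exact h.elim (fun h => Or.inl (Or.inr h)) Or.inr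

/-! ### Counting the messages on a channel -/

open Classical in
/-- Channels neither lose nor create messages. -/
theorem card_recv_add_countP (α : A.system.Execution) {p q : Proc} (hpq : Link p q)
    (Q : Msg V A.M → Prop) (n : ℕ) (hn : (n : ℕ∞) ≤ α.len) :
    ((Finset.range n).filter fun k => ∃ m, Q m ∧ α.act k = .recv p q m).card +
        (A.chan (α.st n) p q hpq).countP Q =
      ((Finset.range n).filter fun k => ∃ m, Q m ∧ α.act k = .send p q m).card := by
  induction n with
  | zero =>
    have : A.chan (α.st 0) p q hpq = 0 := α.st_zero (.inr ⟨(p, q), hpq⟩)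
    simp [this]
  | succ n ih =>
    have hlt : (n : ℕ∞) < α.len := lt_of_lt_of_le (by exact_mod_cast Nat.lt_succ_self n) hn
    have ih := ih hlt.le
    have hs := α.st_succ n hlt
    rw [Finset.range_add_one, Finset.filter_insert, Finset.filter_insert]
    by_cases h₁ : ∃ m, α.act n = .send p q m
    · obtain ⟨m, hm⟩ := h₁
      rw [hm] at hs
      rw [step_chan_send hs hpq, Multiset.countP_cons]
      simp only [hm, reduceCtorEq, and_false, exists_false, if_false, Act.send.injEq, true_and]
      by_cases hQ : Q m <;> simp [hQ] <;> omega
    · by_cases h₂ : ∃ m, α.act n = .recv p q m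
      · obtain ⟨m, hm⟩ := h₂
        rw [hm] at hs
        rw [step_chan_recv hs hpq, Multiset.countP_cons] at ih
        simp only [hm, reduceCtorEq, and_false, exists_false, if_false, Act.recv.injEq, true_and]
        by_cases hQ : Q m <;> simp [hQ] at ih ⊢ <;> omega
      · rw [step_chan_eq hs hpq (fun m h => h₁ ⟨m, h⟩) (fun m h => h₂ ⟨m, h⟩),
          if_neg (fun ⟨m, _, h⟩ => h₂ ⟨m, h⟩), if_neg (fun ⟨m, _, h⟩ => h₁ ⟨m, h⟩)]
        exact ih

theorem exists_send_of_recv {α : A.system.Execution} {p q m j} (h : α.Occurs j (.recv p q m)) :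
    ∃ k, α.Occurs k (.send p q m) := by
  classical
  have hs := α.st_succ j h.1
  rw [h.2] at hs
  have hc := card_recv_add_countP α (carries_of_step_recv hs).1 (· = m) (j + 1)
    (by exact_mod_cast Order.add_one_le_of_lt h.1)
  have hpos : 0 < ((Finset.range (j + 1)).filter
      fun k => ∃ m', m' = m ∧ α.act k = .recv p q m').card :=
    Finset.card_pos.2 ⟨j, Finset.mem_filter.2 ⟨by simp, m, rfl, h.2⟩⟩
  obtain ⟨k, hk⟩ := Finset.card_pos.1 (lt_of_lt_of_le hpos (hc ▸ Nat.le_add_right _ _))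
  obtain ⟨hk', m', rfl, hm⟩ := Finset.mem_filter.1 hk
  refine ⟨k, lt_of_le_of_lt ?_ h.1, hm⟩
  exact_mod_cast Nat.lt_succ_iff.1 (Finset.mem_range.1 hk')

/-- If at most one message with the property `Q` is sent on a channel, then at most one is
received. -/
theorem recv_unique {α : A.system.Execution} {p q} (Q : Msg V A.M → Prop)
    (hQ : ∀ k k' m m', Q m → Q m' → k < k' → α.Occurs k (.send p q m) →
      ¬ α.Occurs k' (.send p q m')) :
    ∀ k k' m m', Q m → Q m' → k < k' → α.Occurs k (.recv p q m) → ¬ α.Occurs k' (.recv p q m') := by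
  classical
  intro j j' m m' hm hm' hlt hj hj'
  have hs := α.st_succ j hj.1
  rw [hj.2] at hs
  have hc := card_recv_add_countP α (carries_of_step_recv hs).1 Q (j' + 1)
    (by exact_mod_cast Order.add_one_le_of_lt hj'.1)
  have htwo : 1 < ((Finset.range (j' + 1)).filter fun k => ∃ m, Q m ∧ α.act k = .recv p q m).card :=
    Finset.one_lt_card.2 ⟨j, Finset.mem_filter.2 ⟨by simp; omega, m, hm, hj.2⟩,
      j', Finset.mem_filter.2 ⟨by simp, m', hm', hj'.2⟩, hlt.ne⟩
  obtain ⟨k, hk, k', hk', hne⟩ :=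
    Finset.one_lt_card.1 (lt_of_lt_of_le htwo (hc ▸ Nat.le_add_right _ _))
  obtain ⟨hk, n, hn, hkn⟩ := Finset.mem_filter.1 hk
  obtain ⟨hk', n', hn', hkn'⟩ := Finset.mem_filter.1 hk'
  have hocc : ∀ i ∈ Finset.range (j' + 1), (i : ℕ∞) < α.len := fun i hi =>
    lt_of_le_of_lt (by exact_mod_cast Nat.lt_succ_iff.1 (Finset.mem_range.1 hi)) hj'.1
  rcases lt_or_gt_of_ne hne with h | h
  · exact hQ k k' n n' hn hn' h ⟨hocc k hk, hkn⟩ ⟨hocc k' hk', hkn'⟩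
  · exact hQ k' k n' n hn' hn h ⟨hocc k' hk', hkn'⟩ ⟨hocc k hk, hkn⟩

end Algorithm

section

variable {V : Fin 2 → Type u} {M I : Type u}

/-! ### The two transactions -/

/-- The transaction that reads both objects. -/
def Inv.readAll : Inv V := .read Finset.univ ⟨0, Finset.mem_univ 0⟩

/-- The transaction that writes the values `w` to both objects. -/
def Inv.writeAll (w : ∀ i, V i) : Inv V := .write (fun i => some (w i)) ⟨0, by simp⟩

/-- The actions `a` and `b` are not invocations at the same client. -/
def DistinctClients (a b : Act V M I) : Prop :=
  ∀ x y, a = .inv x → b = .inv y → x.client ≠ y.client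

theorem DistinctClients.symm {a b : Act V M I} (h : DistinctClients a b) : DistinctClients b a :=
  fun x y hx hy hxy => h y x hy hx hxy.symm

theorem distinctClients_of_ne_left {a b : Act V M I} (h : ∀ x, a ≠ .inv x) : DistinctClients a b :=
  fun x _ hx _ => (h x hx).elim

variable {B : IOAutomaton (Act V M I)}

/-- A finite run in which every client invokes at most one transaction extends to a well-formed fair
execution without further invocations. -/
theorem exists_wellFormed_fair_execution (hc : ∀ s, {t | B.TaskEnabled t s}.Countable)
    (hinv : ∀ x, .inv x ∈ B.acts → .inv x ∈ B.input) {s l s'} (h : B.Run s l s') (hs : s ∈ B.start)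
    (hl : l.Pairwise DistinctClients) :
    ∃ α : B.Execution, α.Fair ∧ WellFormed α ∧ α.st 0 = s ∧ α.st l.length = s' ∧
      (∀ n (hn : n < l.length), α.Occurs n l[n]) ∧
      (∀ n a, l.length ≤ n → α.Occurs n a → a ∉ B.input) ∧
      (∀ n x, α.Occurs n (.inv x) → n < l.length) ∧
      ∀ n k x y, n < k → α.Occurs n (.inv x) → α.Occurs k (.inv y) → x.client ≠ y.client := by
  obtain ⟨α, hf, h0, hst, hpre, hin⟩ := h.exists_fair_execution hc hs
  have hlt : ∀ n x, α.Occurs n (.inv x) → n < l.length := by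
    intro n x hx
    by_contra hn
    refine hin n _ (not_lt.1 hn) hx (hinv x ?_)
    have := α.st_succ n hx.1
    rw [hx.2] at this
    exact B.step_sig _ _ _ this
  have hdist : ∀ n k x y, n < k → α.Occurs n (.inv x) → α.Occurs k (.inv y) →
      x.client ≠ y.client := by
    intro n k x y hnk hx hy
    have hn := hlt n x hx
    have hk := hlt k y hy
    exact List.pairwise_iff_getElem.1 hl n k hn hk hnk x y ((hpre n hn).2.symm.trans hx.2)
      ((hpre k hk).2.symm.trans hy.2)
  exact ⟨α, hf, fun n k x x' hnk hx hx' he => (hdist n k x x' hnk hx hx' he).elim, h0, hst, hpre,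
    hin, hlt, hdist⟩

/-! ### Strict serializability of one read and one write -/

/-- If the only transactions are one read and one write of both objects, the read returns either the
values written or the initial values, and the latter only if the write has not completed before. -/
theorem StrictlySerializable.read_values {v₀ w : ∀ i, V i} {α : B.Execution}
    (hS : StrictlySerializable v₀ α)
    (hinv : ∀ n x, α.Occurs n (.inv x) → x = .readAll ∨ x = .writeAll w) {n m u}
    (hn : RespondsAt α n .readAll m (.values u)) :
    ((∀ i, u i = some (w i)) ∧ ∃ k, α.Occurs k (.inv (.writeAll w))) ∨
      ((∀ i, u i = some (v₀ i)) ∧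
        ∀ k m' y, RespondsAt α k (.writeAll w) m' y → n ≤ m') := by
  obtain ⟨Φ, r, pt, N, e, val, hΦ, hr, he, hpt, hval, hstep⟩ := hS
  obtain ⟨jR, hjR, hejR⟩ := he.surjOn (Or.inl ⟨_, _, _, hn⟩ : n ∈ {n | CompleteAt α n} ∪ Φ)
  have hocc : ∀ j : ℕ, (j : ℕ∞) < N → ∃ x, α.Occurs (e j) (.inv x) := by
    intro j hj
    rcases he.mapsTo hj with ⟨x, m, y, h⟩ | h
    · exact ⟨x, h.1.2.1⟩
    · exact (hΦ _ h).1.1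
  -- The values of the objects are the initial ones until the write has been performed.
  have hvals : ∀ j : ℕ, (j : ℕ∞) ≤ N →
      ((∃ k < j, α.Occurs (e k) (.inv (.writeAll w))) → val j = w) ∧
      ((¬ ∃ k < j, α.Occurs (e k) (.inv (.writeAll w))) → val j = v₀) := by
    intro j
    induction j with
    | zero => exact fun _ => ⟨fun ⟨k, hk, _⟩ => absurd hk (Nat.not_lt_zero k), fun _ => hval⟩
    | succ j ih =>
      intro hj
      have hlt : (j : ℕ∞) < N := lt_of_lt_of_le (by exact_mod_cast Nat.lt_succ_self j) hj
      obtain ⟨ih₁, ih₂⟩ := ih hlt.le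
      obtain ⟨x, hx⟩ := hocc j hlt
      have hs := hstep j x hlt hx.2
      rcases hinv _ _ hx with rfl | rfl
      · have hv : val (j + 1) = val j := (congrArg Prod.snd hs).symm
        have hiff : (∃ k < j + 1, α.Occurs (e k) (.inv (.writeAll w))) ↔
            ∃ k < j, α.Occurs (e k) (.inv (.writeAll w)) := by
          constructor
          · rintro ⟨k, hk, hw⟩
            rcases Nat.lt_succ_iff_lt_or_eq.1 hk with hk | rfl
            · exact ⟨k, hk, hw⟩
            · have := hx.2.symm.trans hw.2
              cases this
          · rintro ⟨k, hk, hw⟩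
            exact ⟨k, by omega, hw⟩
        rw [hv, hiff]
        exact ⟨ih₁, ih₂⟩
      · refine ⟨fun _ => ?_, fun h => (h ⟨j, by omega, hx⟩).elim⟩
        exact (congrArg Prod.snd hs).symm
  have hu : ∀ i, u i = some (val jR i) := by
    intro i
    have hs := hstep jR .readAll hjR (by rw [hejR]; exact hn.1.2.1.2)
    rw [hejR, (hr _ _ _ _ hn).1] at hs
    have h₁ := congrArg Prod.fst hs
    simp only [Inv.readAll, Inv.apply, Finset.mem_univ, if_true, Resp.values.injEq] at h₁
    exact (congrFun h₁ i).symm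
  obtain ⟨h₁, h₂⟩ := hvals jR (le_of_lt hjR)
  by_cases hW : ∃ k < jR, α.Occurs (e k) (.inv (.writeAll w))
  · refine Or.inl ⟨fun i => by rw [hu, h₁ hW], ?_⟩
    obtain ⟨k, -, hk⟩ := hW
    exact ⟨_, hk⟩
  · refine Or.inr ⟨fun i => by rw [hu, h₂ hW], fun k m' y hk => ?_⟩
    by_contra hlt
    obtain ⟨jW, hjW, hejW⟩ := he.surjOn (Or.inl ⟨_, _, _, hk⟩ : k ∈ {n | CompleteAt α n} ∪ Φ)
    refine hW ⟨jW, ?_, hejW ▸ hk.1.2.1⟩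
    have hpt' : pt (e jW) < pt (e jR) := by
      rw [hejW, hejR]
      have h₃ := (hr _ _ _ _ hk).2.2
      have h₄ := (hr _ _ _ _ hn).2.1
      have h₅ : (m' : ℝ) < n := by exact_mod_cast not_le.1 hlt
      linarith
    exact (hpt.lt_iff_lt hjW hjR).1 hpt'

end

namespace Algorithm

variable {V : Fin 2 → Type u} {A : Algorithm V}

theorem inv_mem_input_proc {p : Proc} (x : Inv V) (h : .inv x ∈ (A.proc p).acts) :
    .inv x ∈ (A.proc p).input := by
  rw [A.proc_input]
  rw [mem_acts_proc] at h
  rcases h with h | (⟨_, _, h⟩ | ⟨_, _, _, h⟩) | ⟨_, h⟩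
  · exact h
  · cases h
  · cases h
  · cases h

theorem recv_mem_input_proc {p q r : Proc} {m} (h : .recv q r m ∈ (A.proc p).acts) :
    .recv q r m ∈ (A.proc p).input := by
  rw [A.proc_input]
  rw [mem_acts_proc] at h
  rcases h with h | (⟨_, _, h⟩ | ⟨_, _, _, h⟩) | ⟨_, h⟩
  · exact h
  · cases h
  · cases h
  · cases h

theorem notRecv_of_notMem_input {p : Proc} {a} (h : a ∈ (A.proc p).acts)
    (h' : a ∉ (A.proc p).input) : a.NotRecv ∧ ∀ x, a ≠ .inv x := by
  refine ⟨?_, ?_⟩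
  · rintro q r m rfl
    exact h' (recv_mem_input_proc h)
  · rintro x rfl
    exact h' (inv_mem_input_proc x h)

theorem mem_acts_of_run {B : IOAutomaton (Act V A.M A.I)} {s l s'} (h : B.Run s l s') :
    ∀ a ∈ l, a ∈ B.acts := by
  induction h with
  | nil => simp
  | cons hs _ ih =>
    intro b hb
    rcases List.mem_cons.1 hb with rfl | hb
    · exact B.step_sig _ _ _ hs
    · exact ih b hb

/-! ### The answers of the servers -/

variable (A) in
/-- In the state `y`, on receipt of the read request `x`, server `i` can send the value `v` to the
reader without waiting for any other input. -/
def Answers (i : Fin 2) (x : A.M) (y : (A.proc (.server i)).State) (v : V i) : Prop :=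
  ∃ l y' z, (A.proc (.server i)).Run y (.recv .reader (.server i) (.request x) :: l) y' ∧
    (∀ a ∈ l, a ∉ (A.proc (.server i)).input) ∧ .send (.server i) .reader (.value i v z) ∈ l

/-- In every reachable state each server can answer a read request: the answer comes from a fair
execution of the server alone that receives nothing after the request. -/
theorem exists_answers (hN : A.PropertyN) {s l s'} (hs : s ∈ A.system.start)
    (h : A.system.Run s l s') (i : Fin 2) (x : A.M) : ∃ v, A.Answers i x (A.loc s' (.server i)) v := by
  classical
  have hp := h.component (.inl (.server i))
  set p := l.filter (· ∈ (A.component (.inl (.server i))).acts)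
  have hin : (.recv .reader (.server i) (.request x) : Act V A.M A.I) ∈
      (A.proc (.server i)).input := by
    rw [A.proc_input]
    exact Or.inr ⟨.reader, .request x, ⟨trivial, trivial⟩, rfl⟩
  obtain ⟨y, hy⟩ := (A.proc (.server i)).input_enabled (A.loc s' (.server i)) _ hin
  obtain ⟨α, hf, -, hst, hpre, hpost⟩ :=
    (hp.append (Run.single hy)).exists_fair_execution (countable_enabled_proc _)
      (hs (.inl (.server i)))
  simp only [List.length_append, List.length_singleton] at hst hpre hpost
  have hk : RequestReceived α i p.length := by
    refine ⟨x, ?_⟩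
    have := hpre p.length (by omega)
    rwa [List.getElem_concat_length rfl] at this
  obtain ⟨n, hn, v, z, hv⟩ := hN i α hf p.length hk fun j a hj => hpost j a hj
  have hlen : ((p.length + 1 + (n - p.length) : ℕ) : ℕ∞) ≤ α.len := by
    rw [show p.length + 1 + (n - p.length) = n + 1 by omega]
    exact_mod_cast Order.add_one_le_of_lt hv.1
  have hrun := α.run (p.length + 1) (n - p.length) hlen
  rw [hst] at hrun
  refine ⟨v, _, _, z, .cons hy hrun, ?_, ?_⟩
  · intro a ha
    obtain ⟨j, hj, rfl⟩ := List.mem_map.1 ha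
    rw [List.mem_range'_1] at hj
    refine hpost j _ hj.1 ⟨lt_of_lt_of_le ?_ hlen, rfl⟩
    exact_mod_cast hj.2
  · refine List.mem_map.2 ⟨n, ?_, hv.2⟩
    rw [List.mem_range'_1]
    omega

/-- An answer of a server can be played within the system.  It affects neither the other server nor the
requests in transit to it. -/
theorem Answers.exists_run {s : A.system.State} {i : Fin 2} {x v}
    (h : A.Answers i x (A.loc s (.server i)) v)
    (hx : .request x ∈ A.chan s .reader (.server i) trivial) :
    ∃ l s' z, A.system.Run s l s' ∧ (∀ a ∈ l, ∀ y, a ≠ .inv y) ∧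
      .send (.server i) .reader (.value i v z) ∈ l ∧
      ∀ j, j ≠ i → A.loc s' (.server j) = A.loc s (.server j) ∧
        A.chan s' .reader (.server j) trivial = A.chan s .reader (.server j) trivial := by
  obtain ⟨l, y', z, hrun, hl, hv⟩ := h
  cases hrun with
  | cons hs hrun =>
    obtain ⟨s₁, hs₁, hl₁, hloc₁, hch₁⟩ := exists_step_recv (q := .reader) (p := .server i)
      ⟨trivial, trivial⟩ hx hs
    have hacts := fun a ha => notRecv_of_notMem_input (mem_acts_of_run hrun a ha) (hl a ha)
    obtain ⟨s₂, hs₂, -, hloc₂, hch₂⟩ := exists_run_of_notRecv hl₁ hrun fun a ha => (hacts a ha).1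
    refine ⟨_, s₂, z, .cons hs₁ hs₂, ?_, List.mem_cons_of_mem _ hv, fun j hj => ?_⟩
    · intro a ha y
      rcases List.mem_cons.1 ha with rfl | ha
      · simp
      · exact (hacts a ha).2 y
    · have hne : Proc.server j ≠ .server i := fun h => hj (by cases h; rfl)
      exact ⟨(hloc₂ _ hne).trans (hloc₁ _ hne),
        (hch₂ _ _ _ (by simp)).trans (hch₁ _ _ _ hne)⟩

/-- In an execution with one `READ`, each server sends at most one value to the reader. -/
theorem valueSent_unique {α : A.system.Execution} (hO : OneRound α)
    (hdist : ∀ n k x y, n < k → α.Occurs n (.inv x) → α.Occurs k (.inv y) → x.client ≠ y.client)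
    {i k k'} (hlt : k < k') (hk : ValueSent α i k) : ¬ ValueSent α i k' := by
  intro hk'
  have hrecv := recv_unique (α := α) (p := .reader) (q := .server i)
    (fun m => ∃ x, m = .request x) (by
      rintro n n' _ _ ⟨x, rfl⟩ ⟨x', rfl⟩ hnn hn hn'
      obtain ⟨a, S, hS, -, ha⟩ := hO.request_pending i n ⟨x, hn⟩
      obtain ⟨b, S', hS', hb, -, hb'⟩ := hO.request_once i n n' hnn ⟨x, hn⟩ ⟨x', hn'⟩
      exact hdist a b _ _ (ha.1.trans hb) ha.2.1 hb' rfl)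
  obtain ⟨j', hj', ⟨x', hx'⟩, hno⟩ := hO.value_once i k' hk'
  obtain ⟨j, hj, ⟨x, hx⟩, -⟩ := hO.value_once i k hk
  have hjj : j < j' := by
    by_contra hle
    exact hno k (by omega) hlt hk
  exact hrecv j j' _ _ ⟨x, rfl⟩ ⟨x', rfl⟩ hjj hx hx'

/-- Suppose that a read and possibly a write of both objects have been invoked, that the read
requests are in transit, and that the servers can answer them with the values `v`.  Then the read can
be made to return `v`, so that `v` is subject to strict serializability. -/
theorem answers_eq {v₀ w : ∀ i, V i} (hA : A.SNOW v₀) {s l s'} (hs : s ∈ A.system.start)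
    (hrun : A.system.Run s l s') (hl : l.Pairwise DistinctClients)
    (hinv : ∀ x, .inv x ∈ l → x = .readAll ∨ x = .writeAll w) (hR : .inv .readAll ∈ l)
    {x : Fin 2 → A.M} (hx : ∀ i, .request (x i) ∈ A.chan s' .reader (.server i) trivial)
    {v : ∀ i, V i} (hv : ∀ i, A.Answers i (x i) (A.loc s' (.server i)) (v i)) :
    (v = w ∧ .inv (.writeAll w) ∈ l) ∨
      (v = v₀ ∧ ∀ l₁ l₂, l = .inv (.writeAll w) :: l₁ ++ .inv .readAll :: l₂ → .resp .ok ∉ l₁) := by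
  -- First server `0` and then server `1` answers.
  obtain ⟨l₀, s₁, z₀, hr₀, hn₀, hs₀, hj₀⟩ := (hv 0).exists_run (hx 0)
  obtain ⟨l₁, s₂, z₁, hr₁, hn₁, hs₁, -⟩ := Answers.exists_run (s := s₁) (i := 1) (x := x 1)
    (v := v 1) (by rw [(hj₀ 1 (by decide)).1]; exact hv 1)
    (by rw [(hj₀ 1 (by decide)).2]; exact hx 1)
  have hnot : ∀ a ∈ l₀ ++ l₁, ∀ y, a ≠ .inv y := by
    intro a ha
    rcases List.mem_append.1 ha with ha | ha
    · exact hn₀ a ha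
    · exact hn₁ a ha
  have hpw : (l ++ (l₀ ++ l₁)).Pairwise DistinctClients := by
    refine List.pairwise_append.2 ⟨hl, List.pairwise_of_forall_mem_list fun a ha b hb =>
      distinctClients_of_ne_left (hnot a ha), fun a ha b hb =>
        (distinctClients_of_ne_left (hnot b hb)).symm⟩
  obtain ⟨α, hf, hwf, -, -, hpre, -, hlt, hdist⟩ :=
    exists_wellFormed_fair_execution countable_enabled_system (fun x _ => inv_mem_input x)
      (hrun.append (hr₀.append hr₁)) hs hpw
  have hsend : ∀ i, ∃ n z, α.Occurs n (.send (.server i) .reader (.value i (v i) z)) := by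
    have key : ∀ a ∈ l₀ ++ l₁, ∃ n, α.Occurs n a := by
      intro a ha
      obtain ⟨n, hn, h⟩ := List.getElem_of_mem (List.mem_append_right l ha)
      exact ⟨n, h ▸ hpre n hn⟩
    intro i
    match i with
    | 0 =>
      obtain ⟨n, hn⟩ := key _ (List.mem_append_left _ hs₀)
      exact ⟨n, z₀, hn⟩
    | 1 =>
      obtain ⟨n, hn⟩ := key _ (List.mem_append_right _ hs₁)
      exact ⟨n, z₁, hn⟩
  have hpre' : ∀ n (hn : n < l.length), α.Occurs n l[n] := by
    intro n hn
    have := hpre n (by rw [List.length_append]; omega)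
    rwa [List.getElem_append_left hn] at this
  have hmem : ∀ n y, α.Occurs n (.inv y) → .inv y ∈ l := by
    intro n y hy
    have h₁ := hlt n y hy
    have h₂ : .inv y ∈ l ++ (l₀ ++ l₁) := by
      rw [← hy.2, (hpre n h₁).2]
      exact List.getElem_mem _
    exact (List.mem_append.1 h₂).resolve_right fun h => hnot _ h y rfl
  obtain ⟨n, hn, hnR⟩ := List.getElem_of_mem hR
  have hocc : α.Occurs n (.inv .readAll) := hnR ▸ hpre' n hn
  obtain ⟨x', m, y, hresp⟩ := hA.W α hf hwf n _ hocc
  have hx' := hresp.1.2.1.2.symm.trans hocc.2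
  cases hx'
  have hO := hA.O.2 α hf hwf
  obtain ⟨u, rfl⟩ : ∃ u, y = .values u := by
    cases y with
    | values u => exact ⟨u, rfl⟩
    | ok => exact absurd hresp.2.1 (by simp [Resp.client, Inv.readAll, Inv.client])
  have hu : ∀ i, u i = some (v i) := by
    intro i
    obtain ⟨a, b, c, d, x', val, z, -, -, -, -, -, -, -, hc, -, huv⟩ :=
      hO.round n _ _ m u hresp i (Finset.mem_univ i)
    obtain ⟨k, z', hk⟩ := hsend i
    rcases lt_trichotomy c k with h | rfl | h
    · exact (valueSent_unique hO hdist h ⟨_, _, hc⟩ ⟨_, _, hk⟩).elim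
    · have := hc.2.symm.trans hk.2
      cases this
      exact huv
    · exact (valueSent_unique hO hdist h ⟨_, _, hk⟩ ⟨_, _, hc⟩).elim
  rcases (hA.S α hf hwf).read_values (fun k y hy => hinv y (hmem k y hy)) hresp with
    ⟨h, k, hk⟩ | ⟨h, hbefore⟩
  · exact Or.inl ⟨funext fun i => Option.some.inj ((hu i).symm.trans (h i)), hmem k _ hk⟩
  · refine Or.inr ⟨funext fun i => Option.some.inj ((hu i).symm.trans (h i)), ?_⟩
    rintro l₁ l₂ rfl hok
    have h0 : α.Occurs 0 (.inv (.writeAll w)) := hpre' 0 (by simp)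
    have hlR : α.Occurs (l₁.length + 1) (.inv .readAll) := by
      have := hpre' (l₁.length + 1) (by simp)
      simpa using this
    have hnl : n = l₁.length + 1 := by
      rcases lt_trichotomy n (l₁.length + 1) with h | h | h
      · exact (hdist _ _ _ _ h hocc hlR rfl).elim
      · exact h
      · exact (hdist _ _ _ _ h hlR hocc rfl).elim
    obtain ⟨j, hj, hjok⟩ := List.getElem_of_mem hok
    have hjocc : α.Occurs (j + 1) (.resp .ok) := by
      have := hpre' (j + 1) (by simp; omega)
      simpa [List.getElem_append_left, hj, hjok] using this
    obtain ⟨x', m', y, hW⟩ := hA.W α hf hwf 0 _ h0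
    have hx' := hW.1.2.1.2.symm.trans h0.2
    cases hx'
    have h₁ := hbefore _ _ _ hW
    exact hW.1.2.2 (j + 1) (by omega) (by omega) .ok rfl hjocc

/-! ### The run of the reader and the run of the write -/

/-- The reader, from any reachable state, can invoke the read and send its requests on its own. -/
theorem exists_reader_run (hO : A.IssuesRequests) {s l s'} (hs : s ∈ A.system.start)
    (h : A.system.Run s l s') (hl : ∀ x, .inv x ∈ l → .inv x ∉ (A.proc .reader).acts) :
    ∃ r y, (A.proc .reader).Run (A.loc s' .reader) (.inv .readAll :: r) y ∧
      (∀ a ∈ r, a ∉ (A.proc .reader).input) ∧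
      ∀ i, ∃ x, .send .reader (.server i) (.request x) ∈ r := by
  classical
  have hp := h.component (.inl .reader)
  set p := l.filter (· ∈ (A.component (.inl .reader)).acts) with hpdef
  have hpn : ∀ a ∈ p, ∀ x, a ≠ .inv x := by
    rintro a ha x rfl
    obtain ⟨h₁, h₂⟩ := List.mem_filter.1 ha
    exact hl x h₁ (of_decide_eq_true h₂)
  have hin : (.inv .readAll : Act V A.M A.I) ∈ (A.proc .reader).input := by
    rw [A.proc_input]
    exact Or.inl ⟨_, rfl, rfl⟩
  obtain ⟨y, hy⟩ := (A.proc .reader).input_enabled (A.loc s' .reader) _ hin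
  obtain ⟨α, hf, hwf, -, hst, hpre, hpost, -, -⟩ :=
    exists_wellFormed_fair_execution (countable_enabled_proc _) inv_mem_input_proc
      (hp.append (Run.single hy)) (hs (.inl .reader)) (by
        refine List.pairwise_append.2 ⟨List.pairwise_of_forall_mem_list fun a ha b hb =>
          distinctClients_of_ne_left (hpn a ha), List.pairwise_singleton _ _, fun a ha b hb =>
          distinctClients_of_ne_left (hpn a ha)⟩)
  simp only [List.length_append, List.length_singleton] at hst hpre hpost
  have hk : α.Occurs p.length (.inv .readAll) := by
    have := hpre p.length (by omega)
    rwa [List.getElem_concat_length rfl] at this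
  have hreq := hO α hf hwf p.length _ _ hk fun j a hj => hpost j a hj
  obtain ⟨n₀, hn₀, x₀, hx₀⟩ := hreq 0 (Finset.mem_univ 0)
  obtain ⟨n₁, hn₁, x₁, hx₁⟩ := hreq 1 (Finset.mem_univ 1)
  have hlen : ((p.length + 1 + (max n₀ n₁ - p.length) : ℕ) : ℕ∞) ≤ α.len := by
    rw [show p.length + 1 + (max n₀ n₁ - p.length) = max n₀ n₁ + 1 by omega]
    have : ((max n₀ n₁ : ℕ) : ℕ∞) < α.len := by
      rcases max_choice n₀ n₁ with h | h <;> rw [h]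
      · exact hx₀.1
      · exact hx₁.1
    exact_mod_cast Order.add_one_le_of_lt this
  have hrun := α.run (p.length + 1) (max n₀ n₁ - p.length) hlen
  rw [hst] at hrun
  refine ⟨_, _, .cons hy hrun, ?_, ?_⟩
  · intro a ha
    obtain ⟨j, hj, rfl⟩ := List.mem_map.1 ha
    rw [List.mem_range'_1] at hj
    refine hpost j _ hj.1 ⟨lt_of_lt_of_le ?_ hlen, rfl⟩
    exact_mod_cast hj.2
  · intro i
    match i with
    | 0 =>
      refine ⟨x₀, List.mem_map.2 ⟨n₀, ?_, hx₀.2⟩⟩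
      rw [List.mem_range'_1]
      omega
    | 1 =>
      refine ⟨x₁, List.mem_map.2 ⟨n₁, ?_, hx₁.2⟩⟩
      rw [List.mem_range'_1]
      omega

/-- A write completes in a run in which the reader receives no message, since no value is sent to the
reader without a read request. -/
theorem exists_write_run {v₀ : ∀ i, V i} (hA : A.SNOW v₀) (w : ∀ i, V i) {s}
    (hs : s ∈ A.system.start) :
    ∃ l s', A.system.Run s (.inv (.writeAll w) :: l) s' ∧ .resp .ok ∈ l ∧
      (∀ a ∈ l, ∀ x, a ≠ .inv x) ∧ (∀ a ∈ l, ∀ p m, a ≠ .recv p .reader m) ∧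
      ∀ a ∈ l, ∀ p q x, a ≠ .recv p q (.request x) := by
  obtain ⟨s₁, hs₁⟩ := A.system.input_enabled s _ (inv_mem_input (.writeAll w))
  obtain ⟨α, hf, hwf, h0, -, hpre, -, hlt, -⟩ :=
    exists_wellFormed_fair_execution countable_enabled_system (fun x _ => inv_mem_input x)
      (Run.single hs₁) hs (List.pairwise_singleton _ _)
  have hocc : α.Occurs 0 (.inv (.writeAll w)) := hpre 0 (by simp)
  have hinv : ∀ n x, α.Occurs n (.inv x) → n = 0 := fun n x h => by
    simpa using hlt n x h
  obtain ⟨x, m, y, hresp⟩ := hA.W α hf hwf 0 _ hocc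
  have hx := hresp.1.2.1.2.symm.trans hocc.2
  cases hx
  obtain rfl : y = .ok := by
    cases y with
    | values u => exact absurd hresp.2.1 (by simp [Resp.client, Inv.writeAll, Inv.client])
    | ok => rfl
  have hO := hA.O.2 α hf hwf
  have hreq : ∀ i k, ¬ RequestSent α i k := by
    intro i k hk
    obtain ⟨n, S, hS, -, hn⟩ := hO.request_pending i k hk
    have hn' := hn.2.1
    rw [hinv n _ hn'] at hn'
    have := hn'.2.symm.trans hocc.2
    cases this
  have hrecv : ∀ p q k x, ¬ α.Occurs k (.recv p q (.request x)) := by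
    intro p q k x hk
    have hst := α.st_succ k hk.1
    rw [hk.2] at hst
    obtain ⟨j, hj⟩ := exists_send_of_recv hk
    have hc := carries_of_step_recv hst
    match p, q, hc with
    | .reader, .server i, _ => exact hreq i j ⟨x, hj⟩
    | .reader, .reader, hc => exact hc.1
    | .reader, .writer, hc => exact hc.1
    | .writer, _, hc => exact hc.2
    | .server i, .reader, hc => exact hc.2
    | .server i, .writer, hc => exact hc.2
    | .server i, .server j, hc => exact hc.2
  have hval : ∀ i k, ¬ ValueSent α i k := by
    intro i k hk
    obtain ⟨j, -, ⟨x, hx⟩, -⟩ := hO.value_once i k hk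
    exact hrecv _ _ j x hx
  have hreader : ∀ p k m, ¬ α.Occurs k (.recv p .reader m) := by
    intro p k m hk
    have hst := α.st_succ k hk.1
    rw [hk.2] at hst
    obtain ⟨j, hj⟩ := exists_send_of_recv hk
    have hc := carries_of_step_recv hst
    match p, m, hc with
    | .reader, _, hc => exact hc.1
    | .writer, _, hc => exact hc.1
    | .server i, .request _, hc => exact hc.2
    | .server i, .other _, hc => exact hc.2
    | .server i, .value i' v z, hc =>
      obtain rfl : i = i' := hc.2
      exact hval i j ⟨v, z, hj⟩
  have hlen : ((0 + (m + 1) : ℕ) : ℕ∞) ≤ α.len := by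
    rw [zero_add]
    exact_mod_cast Order.add_one_le_of_lt hresp.2.2.1
  have hrun := α.run 0 (m + 1) hlen
  rw [h0, List.range'_succ, List.map_cons, hocc.2] at hrun
  have key : ∀ a ∈ (List.range' (0 + 1) m).map α.act, ∃ j, 0 < j ∧ α.Occurs j a := by
    intro a ha
    obtain ⟨j, hj, rfl⟩ := List.mem_map.1 ha
    rw [List.mem_range'_1] at hj
    refine ⟨j, by omega, lt_of_lt_of_le ?_ hlen, rfl⟩
    exact_mod_cast (by omega : j < 0 + (m + 1))
  refine ⟨_, _, hrun, List.mem_map.2 ⟨m, ?_, hresp.2.2.2⟩, ?_, ?_, ?_⟩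
  · have := hresp.1.1
    rw [List.mem_range'_1]
    omega
  · rintro a ha x rfl
    obtain ⟨j, hj, ho⟩ := key _ ha
    exact absurd (hinv j x ho) (by omega)
  · rintro a ha p m rfl
    obtain ⟨j, -, ho⟩ := key _ ha
    exact hreader _ _ _ ho
  · rintro a ha p q x rfl
    obtain ⟨j, -, ho⟩ := key _ ha
    exact hrecv _ _ _ _ ho

end Algorithm

end Snow

/-! ### The impossibility -/

open Snow Snow.IOAutomaton Snow.Algorithm in
theorem mainTheorem1 {V : Fin 2 → Type*} [∀ i, Nontrivial (V i)] (v₀ : ∀ i, V i) :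
    ¬ ∃ A : Snow.Algorithm V, A.SNOW v₀ := by
  classical
  rintro ⟨A, hA⟩
  choose w hw using fun i => exists_ne (v₀ i)
  obtain ⟨s₀, hs₀⟩ := A.system.start_nonempty
  obtain ⟨l, s₁, hl, hok, hlinv, hlrecv, hlreq⟩ := exists_write_run hA w hs₀
  have hW : (.inv (.writeAll w) : Act V A.M A.I) ∉ (A.proc .reader).acts := fun h => by
    have h' : (.inv (.writeAll w) : Act V A.M A.I) ∈ (A.proc .writer).acts :=
      mem_acts_proc.2 (Or.inl (Or.inl ⟨_, rfl, rfl⟩))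
    cases eq_of_mem_acts_proc h h'
  obtain ⟨r, y, hr, hrin, hreq⟩ := exists_reader_run hA.O.1 hs₀ hl (by
    intro x hx
    rcases List.mem_cons.1 hx with hx | hx
    · rw [hx]; exact hW
    · exact (hlinv _ hx x rfl).elim)
  choose x hx using hreq
  have hracts := mem_acts_of_run hr
  have hrnot : ∀ a ∈ r, a.NotRecv ∧ ∀ x, a ≠ .inv x := fun a ha =>
    notRecv_of_notMem_input (hracts a (List.mem_cons_of_mem _ ha)) (hrin a ha)
  have hrnot' : ∀ a ∈ .inv .readAll :: r, a.NotRecv := by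
    intro a ha
    rcases List.mem_cons.1 ha with rfl | ha
    · intro p q m h
      cases h
    · exact (hrnot a ha).1
  obtain ⟨s₂, hs₂, -, -, -⟩ := exists_run_of_notRecv rfl hr hrnot'
  -- `γ`: the write completes, and then the read is invoked and sends its requests.
  set γ : List (Act V A.M A.I) := .inv (.writeAll w) :: l ++ .inv .readAll :: r with hγ
  have hγrun : A.system.Run s₀ γ s₂ := hl.append hs₂
  have hγmem : ∀ a ∈ γ, a = .inv (.writeAll w) ∨ a ∈ l ∨ a = .inv .readAll ∨ a ∈ r := by
    intro a ha
    simpa [hγ] using ha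
  have hγpw : γ.Pairwise DistinctClients := by
    rw [hγ, List.cons_append, List.pairwise_cons, List.pairwise_append, List.pairwise_cons]
    refine ⟨?_, ?_, ⟨?_, ?_⟩, ?_⟩
    · intro a ha
      rcases List.mem_append.1 ha with ha | ha
      · exact (distinctClients_of_ne_left (hlinv a ha)).symm
      · rcases List.mem_cons.1 ha with rfl | ha
        · intro x y hx hy h
          cases hx
          cases hy
          cases h
        · exact (distinctClients_of_ne_left (hrnot a ha).2).symm
    · exact List.pairwise_of_forall_mem_list fun a ha b _ => distinctClients_of_ne_left (hlinv a ha)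
    · exact fun a ha => (distinctClients_of_ne_left (hrnot a ha).2).symm
    · exact List.pairwise_of_forall_mem_list fun a ha b _ =>
        distinctClients_of_ne_left (hrnot a ha).2
    · exact fun a ha b _ => distinctClients_of_ne_left (hlinv a ha)
  have hγinv : ∀ x, .inv x ∈ γ → x = .readAll ∨ x = .writeAll w := by
    intro x hx
    rcases hγmem _ hx with h | h | h | h
    · cases h; exact Or.inr rfl
    · exact (hlinv _ h x rfl).elim
    · cases h; exact Or.inl rfl
    · exact ((hrnot _ h).2 x rfl).elim
  have hγreq : ∀ a ∈ γ, ∀ i x, a ≠ .recv .reader (.server i) (.request x) := by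
    rintro a ha i x rfl
    rcases hγmem _ ha with h | h | h | h
    · cases h
    · exact hlreq _ h _ _ _ rfl
    · cases h
    · exact (hrnot _ h).1 _ _ _ rfl
  -- The actions of the reader are moved to the front.
  set P : Act V A.M A.I → Bool := fun a => decide (a ∈ (A.proc .reader).acts) with hP
  have hβrun := hγrun.filter_append P (by
    intro a _ b hb hPa hPb
    refine swaps_system (of_decide_eq_false hPa) (of_decide_eq_true hPb) ?_
    rintro p q m rfl
    rcases hγmem _ hb with h | h | h | h
    · cases h
    · have hq : .recv p q m ∈ (A.proc q).acts := mem_acts_proc.2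
        (Or.inl (Or.inr ⟨p, m, (carries_of_mem_acts (r := q)).2 (of_decide_eq_true hPb), rfl⟩))
      obtain rfl := eq_of_mem_acts_proc (of_decide_eq_true hPb) hq
      exact hlrecv _ h _ _ rfl
    · cases h
    · exact (hrnot _ h).1 _ _ _ rfl)
  have hperm : (γ.filter P ++ γ.filter fun a => !P a).Perm γ := List.filter_append_perm P γ
  set β := γ.filter P with hβ
  set δ := γ.filter fun a => !P a with hδ
  have hRβ : .inv .readAll ∈ β := List.mem_filter.2
    ⟨by simp [hγ], decide_eq_true (hracts _ (by simp))⟩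
  have hWβ : .inv (.writeAll w) ∉ β := fun h => hW (of_decide_eq_true (List.mem_filter.1 h).2)
  have hxβ : ∀ i, .send .reader (.server i) (.request (x i)) ∈ β := fun i =>
    List.mem_filter.2 ⟨by simp [hγ, hx i],
      decide_eq_true (hracts _ (List.mem_cons_of_mem _ (hx i)))⟩
  obtain ⟨t₀, ht₀, hδrun⟩ := hβrun.of_append
  have hsub : ∀ l', l' <+: δ → ∀ a ∈ β ++ l', a ∈ γ := fun l' hl' a ha => hperm.mem_iff.1
    ((List.Sublist.append_left hl'.sublist β).subset ha)
  -- `β ++ l'` satisfies the hypotheses of `answers_eq`.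
  have hpw : ∀ l', l' <+: δ → (β ++ l').Pairwise DistinctClients := fun l' hl' =>
    ((hperm.pairwise_iff fun h => h.symm).2 hγpw).sublist
      (List.Sublist.append_left hl'.sublist β)
  have hchan : ∀ l' t, l' <+: δ → A.system.Run s₀ (β ++ l') t →
      ∀ i, .request (x i) ∈ A.chan t .reader (.server i) trivial := fun l' t hl' ht i =>
    mem_chan_of_run (p := .reader) (q := .server i) trivial ht
      (fun a ha => hγreq a (hsub l' hl' a ha) i (x i))
      (Or.inr (List.mem_append_left _ (hxβ i)))
  have hans : ∀ l' t, l' <+: δ → A.system.Run s₀ (β ++ l') t → ∀ v : ∀ i, V i,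
      (∀ i, A.Answers i (x i) (A.loc t (.server i)) (v i)) →
        (v = w ∧ .inv (.writeAll w) ∈ β ++ l') ∨ v = v₀ := fun l' t hl' ht v hv =>
    (answers_eq hA hs₀ ht (hpw l' hl') (fun y hy => hγinv y (hsub l' hl' _ hy))
      (List.mem_append_left _ hRβ) (hchan l' t hl' ht) hv).imp_right And.left
  -- Along `δ` the answers remain the initial values, as no step changes both servers.
  have hold : ∀ l', l' <+: δ → ∀ t, A.system.Run s₀ (β ++ l') t → ∀ v : ∀ i, V i,
      (∀ i, A.Answers i (x i) (A.loc t (.server i)) (v i)) → v = v₀ := by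
    intro l'
    induction l' using List.reverseRecOn with
    | nil =>
      intro hl' t ht v hv
      refine (hans [] t hl' ht v hv).resolve_left fun h => hWβ ?_
      simpa using h.2
    | append_singleton l' a ih =>
      intro hl' t ht v hv
      have hl'' : l' <+: δ := (List.prefix_append l' [a]).trans hl'
      refine (hans _ t hl' ht v hv).resolve_left fun h => ?_
      rw [← List.append_assoc] at ht
      obtain ⟨t', ht', hstep⟩ := ht.of_append
      cases hstep with
      | cons hstep hnil =>
        cases hnil
        obtain ⟨j, hj⟩ : ∃ j : Fin 2, a ∉ (A.proc (.server j)).acts := by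
          by_contra! hcon
          cases eq_of_mem_acts_proc (hcon 0) (hcon 1)
        choose u hu using fun i => exists_answers hA.N hs₀ ht' i (x i)
        have hmix := ih hl'' t' ht' (Function.update u j (v j)) (by
          intro i
          by_cases hij : i = j
          · subst hij
            rw [Function.update_self, ← step_loc_eq hstep hj]
            exact hv i
          · rw [Function.update_of_ne hij]
            exact hu i)
        have := congrFun hmix j
        rw [Function.update_self, h.1] at this
        exact hw j this
  -- In the final state of `γ` the answers are both the initial values and the values written.
  choose u hu using fun i => exists_answers hA.N hs₀ hγrun i (x i)
  rcases answers_eq hA hs₀ hγrun hγpw hγinv (by simp [hγ])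
    (hchan δ s₂ List.prefix_rfl hβrun) hu with h | h
  · exact hw 0 (congrFun (h.1.symm.trans (hold δ List.prefix_rfl s₂ hβrun u hu)) 0)
  · exact h.2 l r hγ hok
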